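/- Let $d\in\mathbb{N}$ and let $U:\mathbb{R}^d\to\mathbb{R}$ satisfy: (A1) $U$ has a global minimum at $0$ and $U(0)=0$; (A2) $U\in C^2(\mathbb{R}^d)$ and $L:=\sup_x\|D^2U(x)\|<\infty$; (A3) $U\in C^3(\mathbb{R}^d)$ and $L_H:=\sup_x\|D^3U(x)\|<\infty$, where $\|\cdot\|$ is the operator norm of a multilinear form with respect to the Euclidean norm. Let $T>0$ and $h\ge 0$ be such that $T/h\in\mathbb{N}$ if $h\neq 0$. For $(x,v)\in\mathbb{R}^{2d}$ let $\tilde q_T(x,v)$ be defined as follows. If $h>0$, it is the position component after $T/h$ velocity Verlet steps $$q'=q+hv-\tfrac{h^2}{2}\nabla U(q),\qquad v'=v-\tfrac h2\big(\nabla U(q)+\nabla U(q')\big)$$ started from $(x,v)$. If $h=0$, it is the position component at time $T$ of the solution of $\dot q_t=v_t$, $\dot v_t=-\nabla U(q_t)$, $(q_0,v_0)=(x,v)$. Let $\tilde\pi(x,A)=P[\tilde q_T(x,\xi)\in A]$ with $\xi\sim\mathcal N(0,I_d)$ be the one-step transition kernel of unadjusted Hamiltonian Monte Carlo (for $h=0$: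 of exact Hamiltonian Monte Carlo), and for a probability measure $\eta$ on $\mathbb{R}^d$ let $\eta\tilde\pi(A)=\int\tilde\pi(x,A)\,\eta(dx)$. Assume $L(T^2+Th)\le 1/6$. Then for all Borel probability measures $\eta,\nu$ on $\mathbb{R}^d$, $$\mathrm{TV}(\eta\tilde\pi,\nu\tilde\pi)\ \le\ \tfrac32\,\big(T^{-2}+27\,d\,L_H^2\,T^4\big)^{1/2}\;\boldsymbol W^1(\eta,\nu),$$ where $\mathrm{TV}(\nu,\eta)=\sup_A|\nu(A)-\eta(A)|$ over Borel sets $A$, and $\boldsymbol W^1(\eta,\nu)=\inf_\omega\int|x-y|\,\omega(dx\,dy)\in[0,\infty]$ over all couplings $\omega$ of $\eta$ and $\nu$. -/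

import Mathlib

open MeasureTheory ProbabilityTheory Set
open scoped ENNReal NNReal Gradient

namespace UHMC

/-- Euclidean space of dimension `d`. -/
abbrev E (d : ℕ) : Type := EuclideanSpace ℝ (Fin d)

variable {d : ℕ}

/-- `L = sup_x ‖D²U(x)‖`, with the operator norm of a bilinear form. -/
noncomputable def boundHess (U : E d → ℝ) : ℝ := ⨆ x, ‖iteratedFDeriv ℝ 2 U x‖

/-- `L_H = sup_x ‖D³U(x)‖`, with the operator norm of a trilinear form. -/
noncomputable def boundDHess (U : E d → ℝ) : ℝ := ⨆ x, ‖iteratedFDeriv ℝ 3 U x‖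

/-- Assumptions (A1)–(A3) on the potential energy `U`: it has a global minimum at `0` with
`U 0 = 0`, is of class `C³`, and has bounded second and third derivatives. -/
structure Potential (U : E d → ℝ) : Prop where
  map_zero : U 0 = 0
  isMin : ∀ x, U 0 ≤ U x
  contDiff : ContDiff ℝ 3 U
  bdd_hess : BddAbove (range fun x => ‖iteratedFDeriv ℝ 2 U x‖)
  bdd_dhess : BddAbove (range fun x => ‖iteratedFDeriv ℝ 3 U x‖)

/-- One velocity Verlet step of size `h`:
`q' = q + h v - (h²/2) ∇U(q)`, `v' = v - (h/2) (∇U(q) + ∇U(q'))`. -/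
noncomputable def verletStep (U : E d → ℝ) (h : ℝ) (z : E d × E d) : E d × E d :=
  let q' := z.1 + h • z.2 - (h ^ 2 / 2) • ∇ U z.1
  (q', z.2 - (h / 2) • (∇ U z.1 + ∇ U q'))

/-- The Hamiltonian vector field `(q, v) ↦ (v, -∇U(q))`. -/
noncomputable def hamField (U : E d → ℝ) (z : E d × E d) : E d × E d := (z.2, -∇ U z.1)

/-- `γ` solves Hamilton's equations `q' = v`, `v' = -∇U(q)` for all times. -/
def IsTrajectory (U : E d → ℝ) (γ : ℝ → E d × E d) : Prop :=
  ∀ t, HasDerivAt γ (hamField U (γ t)) t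

open Classical in
/-- The exact Hamiltonian flow: the value at time `t` of the solution of Hamilton's equations
started at `z`. For the potentials considered here this solution exists and is unique, see
`existsUnique_trajectory`; the value `z` in the other branch is never used. -/
noncomputable def hamFlow (U : E d → ℝ) (t : ℝ) (z : E d × E d) : E d × E d :=
  if H : ∃ γ : ℝ → E d × E d, γ 0 = z ∧ IsTrajectory U γ then H.choose t else z

/-- The numerical flow for a duration `T` (a multiple of `h` when `h > 0`): `T / h` velocity Verlet
steps of size `h` when `h ≠ 0`, the exact Hamiltonian flow when `h = 0`. -/
noncomputable def numFlow (U : E d → ℝ) (h T : ℝ) (z : E d × E d) : E d × E d :=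
  if h = 0 then hamFlow U T z else (verletStep U h)^[⌊T / h⌋₊] z

theorem lipschitz_gradient {U : E d → ℝ} (hU : Potential U) :
    LipschitzWith (boundHess U).toNNReal (∇ U) := by
  have h1 : LipschitzWith (boundHess U).toNNReal (fderiv ℝ U) := by
    apply lipschitzWith_of_nnnorm_fderiv_le (𝕜 := ℝ)
    · exact (hU.contDiff.fderiv_right (m := 2) (by norm_num)).differentiable (by norm_num)
    · intro x
      rw [← NNReal.coe_le_coe, coe_nnnorm]
      refine le_trans ?_ (Real.le_coe_toNNReal _)
      have h2 : ‖fderiv ℝ (fderiv ℝ U) x‖ = ‖iteratedFDeriv ℝ 2 U x‖ := by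
        rw [← norm_iteratedFDeriv_fderiv, ← norm_iteratedFDeriv_fderiv, norm_iteratedFDeriv_zero]
      rw [h2]
      exact le_ciSup hU.bdd_hess x
  have h3 := (InnerProductSpace.toDual ℝ (E d)).symm.lipschitz.comp h1
  simpa [Function.comp_def, gradient, one_mul] using! h3

theorem contDiff_hamField {U : E d → ℝ} (hU : Potential U) : ContDiff ℝ 1 (hamField U) := by
  have h1 : ContDiff ℝ 1 (fderiv ℝ U) := hU.contDiff.fderiv_right (by norm_num)
  have h2 : ContDiff ℝ 1 (∇ U) :=
    (InnerProductSpace.toDual ℝ (E d)).symm.contDiff.comp h1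
  exact contDiff_snd.prodMk (h2.comp contDiff_fst).neg

theorem lipschitz_hamField {U : E d → ℝ} (hU : Potential U) :
    ∃ K : ℝ≥0, LipschitzWith K (hamField U) :=
  ⟨_, LipschitzWith.prod_snd.prodMk
    (((lipschitz_gradient hU).comp LipschitzWith.prod_fst).neg)⟩

theorem exists_global_solution {V : Type*} [NormedAddCommGroup V] [NormedSpace ℝ V]
    [CompleteSpace V] {f : V → V} (hf : ContDiff ℝ 1 f) {K : ℝ≥0} (hK : LipschitzWith K f) (z : V) :
    ∃ γ : ℝ → V, γ 0 = z ∧ ∀ t, HasDerivAt γ (f (γ t)) t := by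
  set ε : ℝ := (2 * (K + 1))⁻¹ with hε
  have hK0 : (0 : ℝ) ≤ K := K.2
  have hεpos : 0 < ε := by positivity
  have hloc : ∀ x : V, ∃ γ : ℝ → V, γ 0 = x ∧ ∀ t ∈ Ioo (-ε) ε, HasDerivAt γ (f (γ t)) t := by
    intro x
    let a : ℝ≥0 := ‖f x‖₊ + 1
    have hp : IsPicardLindelof (fun _ => f) (tmin := -ε) (tmax := ε)
        ⟨0, by constructor <;> linarith⟩ x a 0 ((K + 1) * a) K :=
      { lipschitzOnWith := fun t _ => hK.lipschitzOnWith
        continuousOn := fun y _ => continuousOn_const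
        norm_le := fun t _ y hy => by
          have h1 := hK.dist_le_mul y x
          rw [dist_eq_norm] at h1
          have h2 : dist y x ≤ a := hy
          have h3 : ‖f y‖ ≤ ‖f x‖ + ‖f y - f x‖ := by
            simpa using norm_add_le (f x) (f y - f x)
          have h4 : ‖f x‖ ≤ a := by simp [a]
          have h5 := mul_le_mul_of_nonneg_left h2 hK0
          push_cast
          linarith
        mul_max_le := by
          have h1 : (0 : ℝ) ≤ a := a.2
          have h2 : ((K : ℝ) + 1) * ε = 1 / 2 := by rw [hε]; field_simp
          simp only [sub_zero, zero_sub, neg_neg, max_self, NNReal.coe_zero]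
          push_cast
          nlinarith }
    obtain ⟨γ, h0, hγ⟩ := hp.exists_eq_forall_mem_Icc_hasDerivWithinAt₀
    exact ⟨γ, h0, fun t ht => (hγ t (Ioo_subset_Icc_self ht)).hasDerivAt (Icc_mem_nhds ht.1 ht.2)⟩
  obtain ⟨γ, h0, hγ⟩ := exists_isMIntegralCurve_of_isMIntegralCurveOn (I := modelWithCornersSelf ℝ V) (v := f)
    (contMDiff_vectorSpace_iff_contDiff.2 hf) hεpos (fun x => by
      obtain ⟨γ, h0, hγ⟩ := hloc x
      exact ⟨γ, h0, fun t ht => (hγ t ht).hasFDerivAt.hasMFDerivAt.hasMFDerivWithinAt⟩) z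
  refine ⟨γ, h0, fun t => ?_⟩
  have h1 : HasFDerivAt γ ((1 : ℝ →L[ℝ] ℝ).smulRight (f (γ t))) t :=
    hasMFDerivAt_iff_hasFDerivAt.1 (hγ t)
  exact hasDerivAt_iff_hasFDerivAt.2 h1

theorem exists_trajectory {U : E d → ℝ} (hU : Potential U) (z : E d × E d) :
    ∃ γ : ℝ → E d × E d, γ 0 = z ∧ IsTrajectory U γ := by
  obtain ⟨K, hK⟩ := lipschitz_hamField hU
  exact exists_global_solution (contDiff_hamField hU) hK z

theorem dist_trajectory_le {U : E d → ℝ} {K : ℝ≥0} (hK : LipschitzWith K (hamField U))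
    {γ γ' : ℝ → E d × E d} (hγ : IsTrajectory U γ) (hγ' : IsTrajectory U γ') (t : ℝ) :
    dist (γ t) (γ' t) ≤ dist (γ 0) (γ' 0) * Real.exp (K * |t|) := by
  have key : ∀ (v : E d × E d → E d × E d) (f g : ℝ → E d × E d), LipschitzWith K v →
      (∀ t, HasDerivAt f (v (f t)) t) → (∀ t, HasDerivAt g (v (g t)) t) → ∀ t, 0 ≤ t →
      dist (f t) (g t) ≤ dist (f 0) (g 0) * Real.exp (K * t) := by
    intro v f g hv hf hg t ht
    have := dist_le_of_trajectories_ODE (v := fun _ => v) (a := 0) (b := t) (fun _ => hv)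
      (fun s _ => (hf s).continuousAt.continuousWithinAt) (fun s _ => (hf s).hasDerivWithinAt)
      (fun s _ => (hg s).continuousAt.continuousWithinAt) (fun s _ => (hg s).hasDerivWithinAt)
      le_rfl t ⟨ht, le_rfl⟩
    simpa using this
  rcases le_total 0 t with ht | ht
  · rw [abs_of_nonneg ht]
    exact key _ γ γ' hK hγ hγ' t ht
  · have rev : ∀ f : ℝ → E d × E d, IsTrajectory U f →
        ∀ s, HasDerivAt (fun s => f (-s)) (-hamField U (f (-s))) s := by
      intro f hf s
      have h1 := (hf (-s)).scomp s (hasDerivAt_neg s)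
      rw [neg_one_smul] at h1
      exact h1
    have := key (fun y => -hamField U y) (fun s => γ (-s)) (fun s => γ' (-s)) hK.neg
      (rev _ hγ) (rev _ hγ') (-t) (by linarith)
    rw [abs_of_nonpos ht]
    simpa using this

/-- Hamilton's equations are globally and uniquely solvable. -/
theorem existsUnique_trajectory {U : E d → ℝ} (hU : Potential U) (z : E d × E d) :
    ∃! γ : ℝ → E d × E d, γ 0 = z ∧ IsTrajectory U γ := by
  obtain ⟨K, hK⟩ := lipschitz_hamField hU
  obtain ⟨γ, h0, hγ⟩ := exists_trajectory hU z
  refine ⟨γ, ⟨h0, hγ⟩, fun γ' h => funext fun t => ?_⟩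
  have := dist_trajectory_le hK h.2 hγ t
  rw [h.1, h0, dist_self, zero_mul] at this
  exact dist_le_zero.1 this

theorem hamFlow_spec {U : E d → ℝ} (hU : Potential U) (z : E d × E d) :
    hamFlow U 0 z = z ∧ IsTrajectory U fun t => hamFlow U t z := by
  have H := exists_trajectory hU z
  have h1 : (fun t => hamFlow U t z) = H.choose := by
    funext t; simp only [hamFlow, dif_pos H]
  exact ⟨by rw [congrFun h1 0]; exact H.choose_spec.1, by rw [h1]; exact H.choose_spec.2⟩

theorem continuous_numFlow {U : E d → ℝ} (hU : Potential U) (h T : ℝ) :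
    Continuous (numFlow U h T) := by
  unfold numFlow
  split_ifs with h0
  · obtain ⟨K, hK⟩ := lipschitz_hamField hU
    refine (LipschitzWith.of_dist_le_mul (K := (Real.exp (K * |T|)).toNNReal)
      fun x y => ?_).continuous
    rw [Real.coe_toNNReal _ (Real.exp_pos _).le, mul_comm]
    have := dist_trajectory_le hK (hamFlow_spec hU x).2 (hamFlow_spec hU y).2 T
    simpa only [(hamFlow_spec hU x).1, (hamFlow_spec hU y).1] using this
  · refine Continuous.iterate ?_ _
    have hg : Continuous (∇ U) := (lipschitz_gradient hU).continuous
    unfold verletStep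
    fun_prop

/-- The one-step transition kernel of unadjusted HMC: the kernel maps `x` to the law of the
position component of the numerical flow at time `T` started at `(x, ξ)` with `ξ ∼ N(0, I_d)`. -/
noncomputable def kernel {U : E d → ℝ} (hU : Potential U) (h T : ℝ) : Kernel (E d) (E d) where
  toFun x := (stdGaussian (E d)).map fun v => (numFlow U h T (x, v)).1
  measurable' := by
    have hm : Measurable fun p : E d × E d => (numFlow U h T p).1 :=
      (continuous_fst.comp (continuous_numFlow hU h T)).measurable
    refine Measure.measurable_of_measurable_coe _ fun s hs => ?_
    have h2 : ∀ x : E d, Measurable fun v => (numFlow U h T (x, v)).1 := fun x =>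
      hm.comp measurable_prodMk_left
    simp_rw [fun x => Measure.map_apply (μ := stdGaussian (E d)) (h2 x) hs]
    exact measurable_measure_prodMk_left (hm hs)

/-- Total variation distance `sup_A |ν(A) - η(A)|` over Borel sets `A`. -/
noncomputable def tv (ν η : Measure (E d)) : ℝ≥0∞ :=
  ⨆ (A : Set (E d)) (_ : MeasurableSet A), ENNReal.ofReal |ν.real A - η.real A|

/-- `ω` is a coupling of `ν` and `η`. -/
def IsCoupling (ω : Measure (E d × E d)) (ν η : Measure (E d)) : Prop :=
  ω.map Prod.fst = ν ∧ ω.map Prod.snd = η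

/-- The `L¹`-Wasserstein distance for the Euclidean metric, with values in `[0, ∞]`. -/
noncomputable def wass (ν η : Measure (E d)) : ℝ≥0∞ :=
  ⨅ (ω : Measure (E d × E d)) (_ : IsCoupling ω ν η), ∫⁻ p, edist p.1 p.2 ∂ω

end UHMC

/-! ### Trace and log-determinant near the identity -/

namespace UHMC

/-! The proof is a one-shot coupling in the velocity. For Verlet started at `x`, the map `v ↦ T⁻¹
q_T(x, v)` is a 1/11-Lipschitz perturbation of the identity plus a constant, hence a C¹
diffeomorphism. So for two starting points `x`, `y` there is a diffeomorphism `Φ` with `q_T(y, Φ v)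
= q_T(x, v)`, and comparing the two laws reduces to comparing `ξ` with `Φ ξ` for a Gaussian `ξ`
(`exists_interpolating_diffeo`). Discrete Gronwall bounds give `‖Φ v - v‖ ≲ |x - y| / T` and,
through the third derivative of `U`, `‖DΦ - 1‖ ≲ T² L_H |x - y|`.

The comparison uses relative entropy. With `g = Φ - id`, it is the Gaussian mean of `⟨v, g⟩ + ‖g‖²/2
- log |det(1 + Dg)|`. Gaussian integration by parts replaces `⟨v, g⟩` by `tr Dg`, and `tr A - log
|det(1 + A)|` is quadratic in `A`. The entropy is thus at most a multiple of `(T⁻² + d L_H² T⁴) |x -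
y|²`, and a Pinsker-type inequality takes the square root (`abs_integral_sub_integral_comp_le`).
This needs `Dg` small, i.e. `x` close to `y`; subdividing the segment from `y` to `x` removes the
restriction.

The exact flow is the limit of Verlet as the step tends to zero. The limit is taken for continuous
test functions, and regularity of measures then gives all Borel sets. Finally the bound on the
kernel is integrated against an arbitrary coupling. -/

theorem sub_sq_le_log_one_add {t : ℝ} (ht : -(1 / 4) ≤ t) :
    t - 4 / 3 * t ^ 2 ≤ Real.log (1 + t) := by
  have h1 : 0 < 1 + t := by linarith
  refine le_trans ?_ (Real.one_sub_inv_le_log_of_pos h1)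
  rw [← sub_nonneg]
  -- The factor `1 + 4 * t` is the reason for the threshold `-(1 / 4)`.
  have : 1 - (1 + t)⁻¹ - (t - 4 / 3 * t ^ 2) = t ^ 2 * (1 + 4 * t) / (3 * (1 + t)) := by
    field_simp
    ring
  rw [this]
  exact div_nonneg (mul_nonneg (sq_nonneg _) (by linarith)) (by linarith)

/-- Diagonalise: every eigenvalue lies within `s` of 1, and the scalar logarithm bound is summed
over the spectrum. -/
theorem trace_sub_sq_le_log_det {V : Type*} [NormedAddCommGroup V] [InnerProductSpace ℝ V]
    [FiniteDimensional ℝ V] (M : V →L[ℝ] V) (hM : (M : V →ₗ[ℝ] V).IsSymmetric) {s : ℝ}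
    (hs : s ≤ 1 / 4) (hMs : ‖M - 1‖ ≤ s) :
    LinearMap.trace ℝ V M - Module.finrank ℝ V * (1 + 4 / 3 * s ^ 2) ≤
      Real.log (LinearMap.det (M : V →ₗ[ℝ] V)) := by
  have hμ : ∀ i, |hM.eigenvalues rfl i - 1| ≤ s := by
    intro i
    have h1 := hM.apply_eigenvectorBasis rfl i
    have h2 : (M - 1) (hM.eigenvectorBasis rfl i) =
        (hM.eigenvalues rfl i - 1) • hM.eigenvectorBasis rfl i := by
      simp only [ContinuousLinearMap.coe_coe] at h1
      simp [h1, sub_smul]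
    have h3 := (M - 1).le_opNorm (hM.eigenvectorBasis rfl i)
    rw [h2, norm_smul] at h3
    simp at h3
    exact h3.trans hMs
  rw [hM.det_eq_prod_eigenvalues rfl, hM.trace_eq_sum_eigenvalues rfl]
  simp only [RCLike.ofReal_real_eq_id, id_eq]
  rw [Real.log_prod]
  · have : (Module.finrank ℝ V : ℝ) * (1 + 4 / 3 * s ^ 2) =
        ∑ i : Fin (Module.finrank ℝ V), (1 + 4 / 3 * s ^ 2) := by
      simp [mul_add]
    rw [this, ← Finset.sum_sub_distrib]
    refine Finset.sum_le_sum fun i _ => ?_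
    have h1 := hμ i
    have h4 := sq_le_sq' (abs_le.1 h1).1 (abs_le.1 h1).2
    have h5 := sub_sq_le_log_one_add (t := hM.eigenvalues rfl i - 1) (by linarith [(abs_le.1 h1).1])
    rw [add_sub_cancel] at h5
    linarith
  · intro i _
    have := (abs_le.1 (hμ i)).1
    intro h
    rw [h] at this
    linarith

/-- `A` need not be symmetric, so the spectral bound is applied to `N* N` with `N = 1 + A`, whose
determinant is `(det N)²`. Its trace is `n + 2 tr A + tr (A* A)`, where `n` is the dimension, and
the last term is nonnegative. -/
theorem trace_sub_log_det_one_add_le {V : Type*} [NormedAddCommGroup V] [InnerProductSpace ℝ V]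
    [FiniteDimensional ℝ V] (A : V →L[ℝ] V) (hA : ‖A‖ ≤ 1 / 10) :
    LinearMap.trace ℝ V A - Real.log |(1 + A).det| ≤
      3 * Module.finrank ℝ V * ‖A‖ ^ 2 := by
  set N : V →L[ℝ] V := 1 + A with hN
  set M : V →L[ℝ] V := N.adjoint * N with hMdef
  have e : M - 1 = A + A.adjoint + A.adjoint * A := by
    rw [hMdef, hN, map_add]
    have : ContinuousLinearMap.adjoint (1 : V →L[ℝ] V) = 1 := star_one (V →L[ℝ] V)
    rw [this]
    noncomm_ring
  have ha := norm_nonneg A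
  have hadj : ‖A.adjoint‖ = ‖A‖ := LinearIsometryEquiv.norm_map _ A
  -- `2‖A‖ + ‖A‖²` with `‖A‖ ≤ 1/10`; the result stays below the 1/4 required for the spectral
  -- bound.
  have hMs : ‖M - 1‖ ≤ 21 / 10 * ‖A‖ := by
    rw [e]
    have h1 := norm_add_le (A + A.adjoint) (A.adjoint * A)
    have h2 := norm_add_le A A.adjoint
    have h3 := norm_mul_le A.adjoint A
    rw [hadj] at h2 h3
    nlinarith
  have hsymm : (M : V →ₗ[ℝ] V).IsSymmetric := by
    intro x y
    simp [hMdef, ContinuousLinearMap.adjoint_inner_left, ContinuousLinearMap.adjoint_inner_right]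
  have key := trace_sub_sq_le_log_det M hsymm (s := 21 / 10 * ‖A‖) (by linarith) hMs
  have htr : (LinearMap.trace ℝ V M : ℝ) = Module.finrank ℝ V + 2 * LinearMap.trace ℝ V A +
      LinearMap.trace ℝ V (A.adjoint * A : V →L[ℝ] V) := by
    have e2 : M = 1 + A + A.adjoint + A.adjoint * A := by
      rw [add_assoc, add_assoc, ← add_assoc A, ← e]; abel
    have h3 : LinearMap.trace ℝ V (A.adjoint : V →L[ℝ] V) = LinearMap.trace ℝ V A := by
      let b := stdOrthonormalBasis ℝ V
      rw [LinearMap.trace_eq_sum_inner _ b, LinearMap.trace_eq_sum_inner _ b]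
      refine Finset.sum_congr rfl fun i _ => ?_
      simp [ContinuousLinearMap.adjoint_inner_right, real_inner_comm]
    rw [e2]
    simp only [ContinuousLinearMap.toLinearMap_add, map_add, h3]
    have : LinearMap.trace ℝ V ((1 : V →L[ℝ] V) : V →ₗ[ℝ] V) = Module.finrank ℝ V :=
      LinearMap.trace_one ℝ V
    rw [this]; ring
  have hpos : 0 ≤ LinearMap.trace ℝ V (A.adjoint * A : V →L[ℝ] V) := by
    let b := stdOrthonormalBasis ℝ V
    rw [LinearMap.trace_eq_sum_inner _ b]
    refine Finset.sum_nonneg fun i _ => ?_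
    simp [ContinuousLinearMap.adjoint_inner_right]
  have hdet : LinearMap.det (M : V →ₗ[ℝ] V) = N.det ^ 2 := by
    have h3 : LinearMap.det (N.adjoint : V →ₗ[ℝ] V) = LinearMap.det (N : V →ₗ[ℝ] V) := by
      let b := stdOrthonormalBasis ℝ V
      rw [← LinearMap.det_toMatrix b.toBasis, ← LinearMap.det_toMatrix b.toBasis]
      have : (N.adjoint : V →ₗ[ℝ] V) = (N : V →ₗ[ℝ] V).adjoint := rfl
      rw [this, LinearMap.toMatrix_adjoint, Matrix.det_conjTranspose, star_trivial]
    have : (M : V →ₗ[ℝ] V) = (N.adjoint : V →ₗ[ℝ] V) * (N : V →ₗ[ℝ] V) := rfl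
    rw [this, map_mul, h3, sq]
  rw [hdet, ← sq_abs N.det, Real.log_pow, htr] at key
  rw [Nat.cast_ofNat] at key
  have hd : (0 : ℝ) ≤ Module.finrank ℝ V := Nat.cast_nonneg _
  -- Half of `4/3 * (21/10)²` is 2.94, rounded up to 3.
  nlinarith [mul_nonneg hd (sq_nonneg ‖A‖)]

/-! ### Gaussian density and integration by parts -/

section Gaussian

variable {V : Type*} [NormedAddCommGroup V] [InnerProductSpace ℝ V] [FiniteDimensional ℝ V]
  [MeasurableSpace V] [BorelSpace V]

/-- The density of the standard Gaussian measure with respect to the volume. -/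
noncomputable def gaussDens (v : V) : ℝ :=
  (∫ x : V, Real.exp (-(1 / 2) * ‖x‖ ^ 2))⁻¹ * Real.exp (-(1 / 2) * ‖v‖ ^ 2)

theorem integral_exp_neg_sq_pos : 0 < ∫ x : V, Real.exp (-(1 / 2) * ‖x‖ ^ 2) := by
  rw [GaussianFourier.integral_rexp_neg_mul_sq_norm (by norm_num)]
  positivity

theorem gaussDens_pos (v : V) : 0 < gaussDens v :=
  mul_pos (inv_pos.2 integral_exp_neg_sq_pos) (Real.exp_pos _)

theorem integrable_exp_neg_sq : Integrable fun x : V => Real.exp (-(1 / 2) * ‖x‖ ^ 2) :=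
  -- The Bochner integral of a non-integrable function is 0 by convention, so a nonzero integral
  -- proves integrability.
  MeasureTheory.Integrable.of_integral_ne_zero integral_exp_neg_sq_pos.ne'

theorem continuous_gaussDens : Continuous (gaussDens : V → ℝ) := by
  unfold gaussDens; fun_prop

theorem measurable_ofReal_gaussDens : Measurable fun v : V => ENNReal.ofReal (gaussDens v) :=
  continuous_gaussDens.measurable.ennreal_ofReal

/-- Both sides are finite measures, so equality of characteristic functions suffices; the right one
is the Gaussian Fourier integral. -/
theorem stdGaussian_eq_withDensity :
    stdGaussian V = volume.withDensity fun v : V => ENNReal.ofReal (gaussDens v) := by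
  have hint : Integrable (gaussDens : V → ℝ) := integrable_exp_neg_sq.const_mul _
  have : IsFiniteMeasure (volume.withDensity fun v : V => ENNReal.ofReal (gaussDens v)) :=
    isFiniteMeasure_withDensity_ofReal hint.2
  refine Measure.ext_of_charFun (funext fun t => ?_)
  rw [charFun_stdGaussian, charFun_apply,
    integral_withDensity_eq_integral_toReal_smul measurable_ofReal_gaussDens (by simp)]
  have hb : 0 < ((1 / 2 : ℂ)).re := by norm_num
  have h1 : ∀ v : V, (ENNReal.ofReal (gaussDens v)).toReal • Complex.exp (inner ℝ v t * Complex.I)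
      = ((∫ x : V, Real.exp (-(1 / 2) * ‖x‖ ^ 2) : ℝ) : ℂ)⁻¹ *
        Complex.exp (-(1 / 2 : ℂ) * ‖v‖ ^ 2 + Complex.I * inner ℝ t v) := by
    intro v
    rw [ENNReal.toReal_ofReal (gaussDens_pos v).le, gaussDens, Complex.real_smul, Complex.exp_add,
      real_inner_comm]
    push_cast
    ring_nf
  have h2 : ((∫ x : V, Real.exp (-(1 / 2) * ‖x‖ ^ 2) : ℝ) : ℂ) =
      ∫ x : V, Complex.exp (-(1 / 2 : ℂ) * ‖x‖ ^ 2) := by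
    rw [← integral_complex_ofReal]
    congr with v
    push_cast
    rfl
  have h3 : ((∫ x : V, Real.exp (-(1 / 2) * ‖x‖ ^ 2) : ℝ) : ℂ) ≠ 0 := by
    exact_mod_cast integral_exp_neg_sq_pos.ne'
  simp_rw [h1]
  rw [integral_const_mul, GaussianFourier.integral_cexp_neg_mul_sq_norm_add hb]
  rw [h2, GaussianFourier.integral_cexp_neg_mul_sq_norm hb] at h3 ⊢
  rw [← mul_assoc, inv_mul_cancel₀ h3, one_mul, Complex.I_sq]
  congr 1
  ring

theorem integrable_stdGaussian_iff {f : V → ℝ} :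
    Integrable f (stdGaussian V) ↔ Integrable fun v => gaussDens v * f v := by
  rw [stdGaussian_eq_withDensity,
    integrable_withDensity_iff_integrable_smul' measurable_ofReal_gaussDens (by simp)]
  simp [ENNReal.toReal_ofReal (gaussDens_pos _).le]

theorem integral_stdGaussian_eq (f : V → ℝ) :
    ∫ v, f v ∂stdGaussian V = ∫ v, gaussDens v * f v := by
  rw [stdGaussian_eq_withDensity,
    integral_withDensity_eq_integral_toReal_smul measurable_ofReal_gaussDens (by simp)]
  simp [ENNReal.toReal_ofReal (gaussDens_pos _).le]

theorem hasFDerivAt_gaussDens (v : V) :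
    HasFDerivAt gaussDens (-(gaussDens v • innerSL ℝ v)) v := by
  have h1 : HasFDerivAt (fun x : V => -(1 / 2 : ℝ) * ‖x‖ ^ 2)
      ((-(1 / 2 : ℝ)) • (2 • innerSL ℝ v)) v :=
    (hasStrictFDerivAt_norm_sq v).hasFDerivAt.const_mul _
  have h2 := h1.exp.const_mul (∫ x : V, Real.exp (-(1 / 2) * ‖x‖ ^ 2))⁻¹
  refine h2.congr_fderiv ?_
  ext w
  simp [gaussDens]
  ring

theorem integrable_norm_stdGaussian : Integrable (fun v : V => ‖v‖) (stdGaussian V) :=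
  (IsGaussian.integrable_id (μ := stdGaussian V)).norm

theorem integrable_inner_mul_of_bounded {f : V → ℝ} (hf : Continuous f) {a : ℝ}
    (ha : ∀ v, |f v| ≤ a) (u : V) :
    Integrable (fun v => inner ℝ u v * f v) (stdGaussian V) := by
  refine (integrable_norm_stdGaussian.const_mul (‖u‖ * a)).mono'
    (by fun_prop) (Filter.Eventually.of_forall fun v => ?_)
  rw [norm_mul, Real.norm_eq_abs, Real.norm_eq_abs]
  have h1 := abs_real_inner_le_norm u v
  have h2 := ha v
  calc _ ≤ (‖u‖ * ‖v‖) * a := by gcongr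
    _ = _ := by ring

theorem integrable_of_bounded {f : V → ℝ} (hf : Continuous f) {a : ℝ}
    (ha : ∀ v, |f v| ≤ a) : Integrable f (stdGaussian V) :=
  Integrable.of_bound hf.aestronglyMeasurable a (Filter.Eventually.of_forall ha)

/-- Gaussian integration by parts for scalar functions. -/
theorem integral_inner_mul_stdGaussian {f : V → ℝ} (hf : ContDiff ℝ 1 f) {a b : ℝ}
    (ha : ∀ v, |f v| ≤ a) (u : V) (hb : ∀ v, |fderiv ℝ f v u| ≤ b) :
    ∫ v, inner ℝ u v * f v ∂stdGaussian V = ∫ v, fderiv ℝ f v u ∂stdGaussian V := by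
  have hd : ∀ v : V, fderiv ℝ gaussDens v u = -(gaussDens v * inner ℝ u v) := fun v => by
    rw [(hasFDerivAt_gaussDens v).fderiv]
    simp [real_inner_comm]
  have hc : Continuous fun v => fderiv ℝ f v u :=
    (hf.continuous_fderiv one_ne_zero).clm_apply continuous_const
  have i1 := integrable_stdGaussian_iff.1 (integrable_inner_mul_of_bounded hf.continuous ha u)
  have i2 := integrable_stdGaussian_iff.1 (integrable_of_bounded hf.continuous ha)
  have i3 := integrable_stdGaussian_iff.1 (integrable_of_bounded hc hb)
  rw [integral_stdGaussian_eq, integral_stdGaussian_eq]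
  -- Integration by parts for Lebesgue measure: the gradient of the density is `-v` times the
  -- density, and integrability of the three products makes boundary terms vanish.
  have := integral_mul_fderiv_eq_neg_fderiv_mul_of_integrable (μ := (volume : Measure V))
    (f := gaussDens) (g := f) (v := u) ?_ i3 i2
    (fun x _ => (hasFDerivAt_gaussDens x).differentiableAt)
    (fun x _ => (hf.differentiable one_ne_zero).differentiableAt)
  · rw [this, ← integral_neg]
    congr with v
    rw [hd]; ring
  · refine i1.neg.congr (Filter.Eventually.of_forall fun v => ?_)
    simp only [Pi.neg_apply, hd]; ring

/-- Gaussian integration by parts for vector fields. -/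
theorem integral_inner_sub_trace_stdGaussian {g : V → V} (hg : ContDiff ℝ 1 g) {a b : ℝ}
    (ha : ∀ v, ‖g v‖ ≤ a) (hb : ∀ v, ‖fderiv ℝ g v‖ ≤ b) :
    Integrable (fun v => inner ℝ v (g v) - LinearMap.trace ℝ V (fderiv ℝ g v)) (stdGaussian V) ∧
    ∫ v, (inner ℝ v (g v) - LinearMap.trace ℝ V (fderiv ℝ g v)) ∂stdGaussian V = 0 := by
  let e := stdOrthonormalBasis ℝ V
  have hfd : ∀ i v, fderiv ℝ (fun w => inner ℝ (e i) (g w)) v (e i) =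
      inner ℝ (e i) (fderiv ℝ g v (e i)) := by
    intro i v
    have h1 := (innerSL ℝ (e i)).hasFDerivAt.comp v
      (hg.differentiable one_ne_zero v).hasFDerivAt
    have h2 : (fun w => inner ℝ (e i) (g w)) = (innerSL ℝ (e i)) ∘ g := rfl
    rw [h2, h1.fderiv]
    rfl
  have hcd : ∀ i, ContDiff ℝ 1 fun w => inner ℝ (e i) (g w) := fun i => contDiff_const.inner ℝ hg
  have ha' : ∀ i v, |inner ℝ (e i) (g v)| ≤ a := fun i v => by
    have := abs_real_inner_le_norm (e i) (g v)
    rw [e.norm_eq_one, one_mul] at this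
    exact this.trans (ha v)
  have hb' : ∀ i v, |fderiv ℝ (fun w => inner ℝ (e i) (g w)) v (e i)| ≤ b := fun i v => by
    rw [hfd]
    have h1 := abs_real_inner_le_norm (e i) (fderiv ℝ g v (e i))
    have h2 := (fderiv ℝ g v).le_opNorm (e i)
    rw [e.norm_eq_one, one_mul] at h1
    rw [e.norm_eq_one, mul_one] at h2
    exact (h1.trans h2).trans (hb v)
  have hc : ∀ i, Continuous fun v => fderiv ℝ (fun w => inner ℝ (e i) (g w)) v (e i) :=
    fun i => ((hcd i).continuous_fderiv one_ne_zero).clm_apply continuous_const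
  have i1 := fun i => integrable_inner_mul_of_bounded (hcd i).continuous (ha' i) (e i)
  have i2 := fun i => integrable_of_bounded (hc i) (hb' i)
  have heq : (fun v => inner ℝ v (g v) - LinearMap.trace ℝ V (fderiv ℝ g v)) = fun v =>
      ∑ i, (inner ℝ (e i) v * inner ℝ (e i) (g v) -
        fderiv ℝ (fun w => inner ℝ (e i) (g w)) v (e i)) := by
    funext v
    rw [Finset.sum_sub_distrib, LinearMap.trace_eq_sum_inner _ e, ← e.sum_inner_mul_inner]
    simp_rw [hfd, real_inner_comm v]
    rfl
  rw [heq]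
  refine ⟨integrable_finsetSum _ fun i _ => (i1 i).sub (i2 i), ?_⟩
  rw [integral_finsetSum Finset.univ (f := fun i v => inner ℝ (e i) v * inner ℝ (e i) (g v) -
    fderiv ℝ (fun w => inner ℝ (e i) (g w)) v (e i)) fun i _ => (i1 i).sub (i2 i)]
  refine Finset.sum_eq_zero fun i _ => ?_
  rw [integral_sub (i1 i) (i2 i), integral_inner_mul_stdGaussian (hcd i) (ha' i) (e i) (hb' i),
    sub_self]

end Gaussian

/-! ### Entropy bound for a near-identity change of variables -/

/-- A pointwise Pinsker-type inequality: with `s = √ρ`, `(s - 1)²` is at most the entropy integrand,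
and `|s - 1| (s + 1)` is split by weighted AM-GM. The weight `t` is optimised after integration. -/
theorem abs_sub_one_le {ρ t : ℝ} (hρ : 0 < ρ) (ht : 0 < t) :
    |ρ - 1| ≤ t / 2 * (ρ - 1 - Real.log ρ) + (ρ + 1) / t := by
  obtain ⟨s, hs, rfl⟩ : ∃ s : ℝ, 0 < s ∧ ρ = s ^ 2 :=
    ⟨√ρ, Real.sqrt_pos.2 hρ, (Real.sq_sqrt hρ.le).symm⟩
  have h1 : (s - 1) ^ 2 ≤ s ^ 2 - 1 - Real.log (s ^ 2) := by
    rw [Real.log_pow]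
    have := Real.log_le_sub_one_of_pos hs
    push_cast
    nlinarith
  have h2 : |s ^ 2 - 1| = |s - 1| * (s + 1) := by
    rw [show s ^ 2 - 1 = (s - 1) * (s + 1) by ring, abs_mul, abs_of_pos (by linarith : 0 < s + 1)]
  have h3 : |s - 1| * (s + 1) ≤ t / 2 * (s - 1) ^ 2 + (s + 1) ^ 2 / (2 * t) := by
    have h4 : t / 2 * (s - 1) ^ 2 + (s + 1) ^ 2 / (2 * t) - |s - 1| * (s + 1) =
        (t * |s - 1| - (s + 1)) ^ 2 / (2 * t) := by
      rw [← sq_abs (s - 1)]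
      field_simp
      ring
    have h5 : 0 ≤ (t * |s - 1| - (s + 1)) ^ 2 / (2 * t) := by positivity
    linarith
  have h4 : (s + 1) ^ 2 / (2 * t) ≤ (s ^ 2 + 1) / t := by
    rw [div_le_div_iff₀ (by positivity) ht]
    nlinarith [mul_nonneg ht.le (sq_nonneg (s - 1))]
  rw [h2]
  have h5 := mul_le_mul_of_nonneg_left h1 (by positivity : 0 ≤ t / 2)
  linarith

theorem det_one_add_ne_zero {V : Type*} [NormedAddCommGroup V] [InnerProductSpace ℝ V]
    [FiniteDimensional ℝ V] (A : V →L[ℝ] V) (hA : ‖A‖ < 1) : (1 + A).det ≠ 0 := by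
  have h1 : IsUnit (1 + A) := by
    rw [← sub_neg_eq_add]
    exact isUnit_one_sub_of_norm_lt_one (by rwa [norm_neg])
  have h2 : IsUnit ((1 + A : V →L[ℝ] V) : V →ₗ[ℝ] V) :=
    h1.map (ContinuousLinearMap.toLinearMapRingHom : (V →L[ℝ] V) →+* (V →ₗ[ℝ] V))
  exact ((LinearMap.isUnit_iff_isUnit_det _).1 h2).ne_zero

section Gaussian

variable {V : Type*} [NormedAddCommGroup V] [InnerProductSpace ℝ V] [FiniteDimensional ℝ V]
  [MeasurableSpace V] [BorelSpace V]

/-- The density of the pullback of the standard Gaussian measure under `Φ` with respect to the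
standard Gaussian measure. -/
noncomputable def pullDens (Φ : V → V) (v : V) : ℝ :=
  |(fderiv ℝ Φ v).det| * gaussDens (Φ v) / gaussDens v

theorem gaussDens_mul_pullDens (Φ : V → V) (v : V) :
    gaussDens v * pullDens Φ v = |(fderiv ℝ Φ v).det| * gaussDens (Φ v) :=
  mul_div_cancel₀ _ (gaussDens_pos v).ne'

/-- Change of variables by `Φ` in Lebesgue measure. Thus `pullDens Φ` is the density of the law of
`Φ⁻¹ ξ` relative to that of `ξ`. -/
theorem integral_comp_mul_pullDens {Φ : V → V} (hΦ : Differentiable ℝ Φ)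
    (hbij : Function.Bijective Φ) (f : V → ℝ) :
    ∫ v, f v ∂stdGaussian V = ∫ v, f (Φ v) * pullDens Φ v ∂stdGaussian V := by
  rw [integral_stdGaussian_eq, integral_stdGaussian_eq]
  have h := integral_image_eq_integral_abs_det_fderiv_smul (volume : Measure V)
    MeasurableSet.univ (fun x _ => (hΦ x).hasFDerivAt.hasFDerivWithinAt) hbij.1.injOn
    (fun v => gaussDens v * f v)
  rw [image_univ, hbij.2.range_eq, Measure.restrict_univ] at h
  rw [h]
  congr with v
  rw [mul_left_comm, gaussDens_mul_pullDens, smul_eq_mul]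
  ring

theorem integrable_pullDens {Φ : V → V} (hΦ : Differentiable ℝ Φ)
    (hbij : Function.Bijective Φ) : Integrable (pullDens Φ) (stdGaussian V) := by
  rw [integrable_stdGaussian_iff]
  have h := integrableOn_image_iff_integrableOn_abs_det_fderiv_smul (volume : Measure V)
    MeasurableSet.univ (fun x _ => (hΦ x).hasFDerivAt.hasFDerivWithinAt) hbij.1.injOn
    gaussDens
  rw [image_univ, hbij.2.range_eq, integrableOn_univ, integrableOn_univ] at h
  simp_rw [gaussDens_mul_pullDens]
  exact h.1 (integrable_exp_neg_sq.const_mul _)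

theorem log_pullDens {Φ : V → V} {v : V} (hdet : (fderiv ℝ Φ v).det ≠ 0) :
    Real.log (pullDens Φ v) =
      Real.log |(fderiv ℝ Φ v).det| - (‖Φ v‖ ^ 2 - ‖v‖ ^ 2) / 2 := by
  have h1 : ∀ w : V, Real.log (gaussDens w) =
      Real.log (∫ x : V, Real.exp (-(1 / 2) * ‖x‖ ^ 2))⁻¹ + -(1 / 2) * ‖w‖ ^ 2 := fun w => by
    rw [gaussDens, Real.log_mul (inv_pos.2 integral_exp_neg_sq_pos).ne' (Real.exp_pos _).ne',
      Real.log_exp]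
  rw [pullDens, Real.log_div (mul_pos (abs_pos.2 hdet) (gaussDens_pos _)).ne' (gaussDens_pos _).ne',
    Real.log_mul (abs_pos.2 hdet).ne' (gaussDens_pos _).ne', h1, h1]
  ring

/-- A `C¹`-diffeomorphism close to the identity changes Gaussian expectations of functions with
values in `[0, 1]` only slightly. -/
theorem abs_integral_sub_integral_comp_le {Φ : V → V} (hΦ : ContDiff ℝ 1 Φ)
    (hbij : Function.Bijective Φ) {a b : ℝ} (ha : ∀ v, ‖Φ v - v‖ ≤ a) (hb1 : b ≤ 1 / 10)
    (hb : ∀ v, ‖fderiv ℝ Φ v - 1‖ ≤ b) {K : ℝ} (hK0 : 0 < K)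
    (hK : a ^ 2 / 2 + 3 * Module.finrank ℝ V * b ^ 2 ≤ K) {f : V → ℝ} (hf : Measurable f)
    (hf0 : ∀ v, 0 ≤ f v) (hf1 : ∀ v, f v ≤ 1) :
    |∫ v, f v ∂stdGaussian V - ∫ v, f (Φ v) ∂stdGaussian V| ≤ √K := by
  have hd := hΦ.differentiable one_ne_zero
  set ρ := pullDens Φ with hρ
  have hρi : Integrable ρ (stdGaussian V) := integrable_pullDens hd hbij
  have hρ1 : ∫ v, ρ v ∂stdGaussian V = 1 := by
    have := integral_comp_mul_pullDens hd hbij (fun _ => (1 : ℝ))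
    simpa using this.symm
  set g : V → V := fun v => Φ v - v with hg
  have hgd : ContDiff ℝ 1 g := hΦ.sub contDiff_id
  have hgf : ∀ v, fderiv ℝ g v = fderiv ℝ Φ v - 1 := fun v => by
    exact ((hd v).hasFDerivAt.sub (hasFDerivAt_id v)).fderiv
  obtain ⟨hS, hS0⟩ := integral_inner_sub_trace_stdGaussian hgd ha (fun v => (hgf v) ▸ hb v)
  set S : V → ℝ := fun v => inner ℝ v (g v) - LinearMap.trace ℝ V (fderiv ℝ g v) with hSdef
  have ha0 : 0 ≤ a := (norm_nonneg _).trans (ha 0)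
  have hb0 : 0 ≤ b := (norm_nonneg _).trans (hb 0)
  have hdet : ∀ v, (fderiv ℝ Φ v).det ≠ 0 := fun v => by
    have := det_one_add_ne_zero (fderiv ℝ Φ v - 1) ((hb v).trans_lt (by linarith))
    rwa [add_sub_cancel] at this
  have hρpos : ∀ v, 0 < ρ v := fun v =>
    div_pos (mul_pos (abs_pos.2 (hdet v)) (gaussDens_pos _)) (gaussDens_pos _)
  -- Trading `log |det|` for the trace costs a quadratic term absorbed in `K`; what remains is `S`,
  -- which has Gaussian mean zero.
  have hlog : ∀ v, -Real.log (ρ v) ≤ S v + K := by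
    intro v
    have h1 := trace_sub_log_det_one_add_le (fderiv ℝ Φ v - 1) ((hb v).trans hb1)
    rw [add_sub_cancel, ← hgf] at h1
    rw [hρ, log_pullDens (hdet v)]
    have h2 : ‖Φ v‖ ^ 2 = ‖v‖ ^ 2 + 2 * inner ℝ v (g v) + ‖g v‖ ^ 2 := by
      rw [← norm_add_sq_real]; simp [hg]
    have h3 : ‖g v‖ ^ 2 ≤ a ^ 2 := pow_le_pow_left₀ (norm_nonneg _) (ha v) 2
    have h4 : ‖fderiv ℝ g v‖ ^ 2 ≤ b ^ 2 := pow_le_pow_left₀ (norm_nonneg _) (hgf v ▸ hb v) 2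
    have h5 : 3 * Module.finrank ℝ V * ‖fderiv ℝ g v‖ ^ 2 ≤ 3 * Module.finrank ℝ V * b ^ 2 := by
      gcongr
    simp only [hSdef]
    linarith
  -- The minimiser of `t / 2 * K + 2 / t`.
  set t : ℝ := 2 / √K with ht
  have hsK : 0 < √K := Real.sqrt_pos.2 hK0
  have ht0 : 0 < t := by positivity
  have i1 : Integrable (fun v => ρ v - 1) (stdGaussian V) := hρi.sub (integrable_const 1)
  have hbound : ∫ v, |ρ v - 1| ∂stdGaussian V ≤ 2 * √K := by
    have iS : Integrable (fun v => S v + K) (stdGaussian V) := hS.add (integrable_const K)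
    have i2 : Integrable (fun v => ρ v - 1 + (S v + K)) (stdGaussian V) := i1.add iS
    have i3 : Integrable (fun v => ρ v + 1) (stdGaussian V) := hρi.add (integrable_const 1)
    calc ∫ v, |ρ v - 1| ∂stdGaussian V
        ≤ ∫ v, (t / 2 * (ρ v - 1 + (S v + K)) + (ρ v + 1) / t) ∂stdGaussian V := by
          refine integral_mono i1.abs ((i2.const_mul _).add (i3.div_const _)) fun v => ?_
          refine (abs_sub_one_le (hρpos v) ht0).trans ?_
          have := hlog v
          gcongr
          linarith
      _ = t / 2 * K + 2 / t := by
          rw [integral_add (i2.const_mul _) (i3.div_const _), integral_const_mul,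
            integral_div, integral_add i1 iS,
            integral_sub hρi (integrable_const 1), integral_add hS (integrable_const K),
            integral_add hρi (integrable_const 1), hS0, hρ1]
          simp
          norm_num
      _ = 2 * √K := by
          rw [ht]
          have := Real.sq_sqrt hK0.le
          field_simp
          nlinarith
  -- Since `ρ - 1` has mean zero, `f` may be centred at 1/2; this halves the L¹ bound `2 * √K`.
  have hfb : ∀ v, |f v - 1 / 2| ≤ 1 / 2 := fun v => abs_le.2 ⟨by linarith [hf0 v], by linarith [hf1 v]⟩
  have hΦm : Measurable Φ := hΦ.continuous.measurable
  have i4 : Integrable (fun v => f (Φ v)) (stdGaussian V) :=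
    Integrable.of_bound (hf.comp hΦm).aestronglyMeasurable 1 (Filter.Eventually.of_forall fun v => by
      rw [Real.norm_eq_abs, abs_of_nonneg (hf0 _)]; exact hf1 _)
  have i5 : Integrable (fun v => f (Φ v) * ρ v) (stdGaussian V) :=
    hρi.bdd_mul (c := 1) (hf.comp hΦm).aestronglyMeasurable (Filter.Eventually.of_forall fun v => by
      rw [Real.norm_eq_abs, abs_of_nonneg (hf0 _)]; exact hf1 _)
  have heq : ∫ v, f v ∂stdGaussian V - ∫ v, f (Φ v) ∂stdGaussian V =
      ∫ v, (f (Φ v) - 1 / 2) * (ρ v - 1) ∂stdGaussian V := by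
    have : ∀ v, (f (Φ v) - 1 / 2) * (ρ v - 1) =
        (f (Φ v) * ρ v - f (Φ v)) - 1 / 2 * (ρ v - 1) := fun v => by ring
    simp_rw [this]
    have i6 : Integrable (fun v => f (Φ v) * ρ v - f (Φ v)) (stdGaussian V) := i5.sub i4
    rw [integral_sub i6 (i1.const_mul _), integral_sub i5 i4, integral_const_mul, integral_sub hρi (integrable_const 1), hρ1,
      integral_comp_mul_pullDens hd hbij f]
    simp [hρ]
  rw [heq, ← Real.norm_eq_abs]
  calc ‖∫ v, (f (Φ v) - 1 / 2) * (ρ v - 1) ∂stdGaussian V‖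
      ≤ ∫ v, 1 / 2 * |ρ v - 1| ∂stdGaussian V := by
        refine norm_integral_le_of_norm_le
          (i1.abs.const_mul _) (Filter.Eventually.of_forall fun v => ?_)
        rw [Real.norm_eq_abs, abs_mul]
        exact mul_le_mul_of_nonneg_right (hfb _) (abs_nonneg _)
    _ = 1 / 2 * ∫ v, |ρ v - 1| ∂stdGaussian V := integral_const_mul _ _
    _ ≤ √K := by linarith

end Gaussian

/-! ### Discrete Taylor and Gronwall bounds -/

section Discrete

variable {F : Type*} [NormedAddCommGroup F] [NormedSpace ℝ F]

theorem discrete_taylor_bound {a b : ℕ → F} {h B : ℝ} {n : ℕ} (hh : 0 ≤ h)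
    (hb : ∀ k < n, ‖b (k + 1) - b k‖ ≤ h * B)
    (ha : ∀ k < n, ‖a (k + 1) - a k - h • b k‖ ≤ h ^ 2 / 2 * B) :
    ∀ k ≤ n, ‖b k - b 0‖ ≤ k * h * B ∧
      ‖a k - a 0 - (k * h) • b 0‖ ≤ (k * h) ^ 2 / 2 * B := by
  intro k
  induction k with
  | zero => simp
  | succ k ih =>
    intro hk
    obtain ⟨h1, h2⟩ := ih (by omega)
    have h3 := hb k (by omega)
    have h4 := ha k (by omega)
    have e1 : b (k + 1) - b 0 = (b (k + 1) - b k) + (b k - b 0) := by abel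
    have e2 : a (k + 1) - a 0 - ((k + 1 : ℕ) * h) • b 0 =
        (a (k + 1) - a k - h • b k) + (a k - a 0 - (k * h) • b 0) + h • (b k - b 0) := by
      push_cast
      module
    constructor
    · rw [e1]
      refine (norm_add_le _ _).trans ?_
      push_cast
      linarith
    · rw [e2]
      refine (norm_add₃_le).trans ?_
      rw [norm_smul, Real.norm_of_nonneg hh]
      have h5 := mul_le_mul_of_nonneg_left h1 hh
      push_cast
      nlinarith

/-- The hypothesis `H` is fed the actual maximum of `‖a k‖`, and the Taylor bound then controls that
maximum by itself with factor `L T² / 2 ≤ 1/12`. Absorbing it gives the constant 12/11. -/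
theorem discrete_gronwall_bound {a b : ℕ → F} {h T L c : ℝ} {n : ℕ} (hh : 0 ≤ h) (hT : n * h = T)
    (hL : 0 ≤ L) (hLT : L * T ^ 2 ≤ 1 / 6)
    (H : ∀ M, (∀ k ≤ n, ‖a k‖ ≤ M) → ∀ k < n, ‖b (k + 1) - b k‖ ≤ h * (L * M + c) ∧
      ‖a (k + 1) - a k - h • b k‖ ≤ h ^ 2 / 2 * (L * M + c)) {M : ℝ}
    (hM : M = 12 / 11 * (‖a 0‖ + T * ‖b 0‖ + T ^ 2 / 2 * c)) (hc : 0 ≤ c) :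
    (∀ k ≤ n, ‖a k‖ ≤ M) ∧ ‖a n - a 0 - T • b 0‖ ≤ T ^ 2 / 2 * (L * M + c) := by
  have hT0 : 0 ≤ T := hT ▸ by positivity
  obtain ⟨m, hm, hmax⟩ := Finset.exists_max_image (Finset.range (n + 1)) (fun k => ‖a k‖)
    ⟨0, by simp⟩
  set M' := ‖a m‖ with hM'
  have hM'0 : 0 ≤ M' := norm_nonneg _
  have hle : ∀ k ≤ n, ‖a k‖ ≤ M' := fun k hk => hmax k (by simp; omega)
  have key := discrete_taylor_bound hh (fun k hk => (H M' hle k hk).1)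
    (fun k hk => (H M' hle k hk).2)
  have hmn : m ≤ n := by simp at hm; omega
  have hkh : (m : ℝ) * h ≤ T := by rw [← hT]; gcongr
  have hkh0 : 0 ≤ (m : ℝ) * h := by positivity
  have h1 := (key m hmn).2
  have h2 : a m = (a m - a 0 - (m * h) • b 0) + a 0 + (m * h) • b 0 := by abel
  have h3 : M' ≤ T ^ 2 / 2 * (L * M' + c) + ‖a 0‖ + T * ‖b 0‖ := by
    calc M' = ‖(a m - a 0 - (m * h) • b 0) + a 0 + (m * h) • b 0‖ := by rw [← h2]
      _ ≤ ‖a m - a 0 - (m * h) • b 0‖ + ‖a 0‖ + ‖(m * h) • b 0‖ := norm_add₃_le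
      _ ≤ (m * h) ^ 2 / 2 * (L * M' + c) + ‖a 0‖ + (m * h) * ‖b 0‖ := by
        rw [norm_smul, Real.norm_of_nonneg hkh0]; gcongr
      _ ≤ _ := by gcongr
  have h4 : M' ≤ M := by
    rw [hM]
    nlinarith [mul_le_mul_of_nonneg_right hLT hM'0]
  have hle' : ∀ k ≤ n, ‖a k‖ ≤ M := fun k hk => (hle k hk).trans h4
  refine ⟨hle', ?_⟩
  have := (discrete_taylor_bound hh (fun k hk => (H M hle' k hk).1)
    (fun k hk => (H M hle' k hk).2) n le_rfl).2
  rwa [hT] at this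

/-- Stated for an abstract force `f`, so that it covers differences of trajectories, Jacobians, and
differences of Jacobians; `c` is the inhomogeneity. -/
theorem verlet_recursion_bound {a b f : ℕ → F} {h T L c : ℝ} {n : ℕ} (hh : 0 ≤ h)
    (hT : n * h = T) (hL : 0 ≤ L) (hLT : L * T ^ 2 ≤ 1 / 6)
    (ha : ∀ k < n, a (k + 1) = a k + h • b k - (h ^ 2 / 2) • f k)
    (hb : ∀ k < n, b (k + 1) = b k - (h / 2) • (f k + f (k + 1)))
    (hf : ∀ k ≤ n, ‖f k‖ ≤ L * ‖a k‖ + c) (hc : 0 ≤ c) {M : ℝ}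
    (hM : M = 12 / 11 * (‖a 0‖ + T * ‖b 0‖ + T ^ 2 / 2 * c)) :
    (∀ k ≤ n, ‖a k‖ ≤ M) ∧ ‖a n - a 0 - T • b 0‖ ≤ T ^ 2 / 2 * (L * M + c) := by
  refine discrete_gronwall_bound hh hT hL hLT (fun M hM k hk => ?_) hM hc
  have h1 : ∀ j ≤ n, ‖f j‖ ≤ L * M + c := fun j hj => (hf j hj).trans (by
    have := mul_le_mul_of_nonneg_left (hM j hj) hL
    linarith)
  constructor
  · rw [hb k hk, sub_sub_cancel_left, norm_neg, norm_smul, Real.norm_of_nonneg (by positivity)]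
    have h2 := norm_add_le (f k) (f (k + 1))
    have h3 := h1 k hk.le
    have h4 := h1 (k + 1) hk
    calc h / 2 * ‖f k + f (k + 1)‖ ≤ h / 2 * (2 * (L * M + c)) := by gcongr; linarith
      _ = _ := by ring
  · rw [ha k hk]
    have : a k + h • b k - (h ^ 2 / 2) • f k - a k - h • b k = -((h ^ 2 / 2) • f k) := by abel
    rw [this, norm_neg, norm_smul, Real.norm_of_nonneg (by positivity)]
    gcongr
    exact h1 k hk.le

end Discrete

/-! ### Verlet as a function of its initial data -/

theorem norm_fderiv_fderiv_sub_le {F : Type*} [NormedAddCommGroup F] [NormedSpace ℝ F]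
    {f : F → ℝ} (hf : ContDiff ℝ 3 f) {C : ℝ} (hC : ∀ z, ‖iteratedFDeriv ℝ 3 f z‖ ≤ C) (x y : F) :
    ‖fderiv ℝ (fderiv ℝ f) x - fderiv ℝ (fderiv ℝ f) y‖ ≤ C * ‖x - y‖ := by
  have hd2 : ContDiff ℝ 2 (fderiv ℝ f) := hf.fderiv_right (by norm_num)
  have hd1 : ContDiff ℝ 1 (fderiv ℝ (fderiv ℝ f)) := hd2.fderiv_right (by norm_num)
  refine convex_univ.norm_image_sub_le_of_norm_fderiv_le (𝕜 := ℝ)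
    (fun z _ => hd1.differentiable one_ne_zero z) (fun z _ => ?_) (mem_univ y) (mem_univ x)
  refine le_of_eq_of_le ?_ (hC z)
  rw [← norm_iteratedFDeriv_fderiv, ← norm_iteratedFDeriv_fderiv, ← norm_iteratedFDeriv_fderiv,
    norm_iteratedFDeriv_zero]

section Verlet

variable {d : ℕ} {U : E d → ℝ}

/-- The position after `k` Verlet steps, as a function of the initial velocity. -/
noncomputable def verletPos (U : E d → ℝ) (h : ℝ) (x : E d) (k : ℕ) (v : E d) : E d :=
  ((verletStep U h)^[k] (x, v)).1

/-- The velocity after `k` Verlet steps, as a function of the initial velocity. -/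
noncomputable def verletVel (U : E d → ℝ) (h : ℝ) (x : E d) (k : ℕ) (v : E d) : E d :=
  ((verletStep U h)^[k] (x, v)).2

theorem verletPos_zero (h : ℝ) (x v : E d) : verletPos U h x 0 v = x := rfl

theorem verletVel_zero (h : ℝ) (x v : E d) : verletVel U h x 0 v = v := rfl

theorem verletPos_succ (h : ℝ) (x : E d) (k : ℕ) (v : E d) :
    verletPos U h x (k + 1) v = verletPos U h x k v + h • verletVel U h x k v -
      (h ^ 2 / 2) • ∇ U (verletPos U h x k v) := by
  simp only [verletPos, verletVel, Function.iterate_succ_apply', verletStep]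

theorem verletVel_succ (h : ℝ) (x : E d) (k : ℕ) (v : E d) :
    verletVel U h x (k + 1) v = verletVel U h x k v -
      (h / 2) • (∇ U (verletPos U h x k v) + ∇ U (verletPos U h x (k + 1) v)) := by
  simp only [verletPos, verletVel, Function.iterate_succ_apply', verletStep]

theorem boundHess_nonneg : 0 ≤ boundHess U := Real.iSup_nonneg fun _ => norm_nonneg _

theorem boundDHess_nonneg : 0 ≤ boundDHess U := Real.iSup_nonneg fun _ => norm_nonneg _

theorem norm_gradient_sub_le (hU : Potential U) (x y : E d) :
    ‖∇ U x - ∇ U y‖ ≤ boundHess U * ‖x - y‖ := by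
  have := (lipschitz_gradient hU).norm_sub_le x y
  rwa [Real.coe_toNNReal _ boundHess_nonneg] at this

theorem contDiff_gradient (hU : Potential U) : ContDiff ℝ 2 (∇ U) :=
  (InnerProductSpace.toDual ℝ (E d)).symm.contDiff.comp (hU.contDiff.fderiv_right (by norm_num))

theorem norm_fderiv_gradient_le (hU : Potential U) (x : E d) :
    ‖fderiv ℝ (∇ U) x‖ ≤ boundHess U := by
  have := norm_fderiv_le_of_lipschitz ℝ (lipschitz_gradient hU) (x₀ := x)
  rwa [Real.coe_toNNReal _ boundHess_nonneg] at this

/-- The derivative of `∇ U` represents the second derivative of `U` by Riesz duality; testing the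
difference against its own value `X` transfers the operator norm bound. -/
theorem norm_fderiv_gradient_sub_le (hU : Potential U) (x y : E d) :
    ‖fderiv ℝ (∇ U) x - fderiv ℝ (∇ U) y‖ ≤ boundDHess U * ‖x - y‖ := by
  have hd2 : ContDiff ℝ 2 (fderiv ℝ U) := hU.contDiff.fderiv_right (by norm_num)
  have h3 := norm_fderiv_fderiv_sub_le hU.contDiff (fun z => le_ciSup hU.bdd_dhess z) x y
  have h4 : ∀ z u w, inner ℝ (fderiv ℝ (∇ U) z u) w = fderiv ℝ (fderiv ℝ U) z u w := by
    intro z u w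
    have e1 : HasFDerivAt (fun z => inner ℝ (∇ U z) w) _ z :=
      ((contDiff_gradient hU).differentiable two_ne_zero z).hasFDerivAt.inner ℝ
        (hasFDerivAt_const w z)
    have e2 : HasFDerivAt (fun z => fderiv ℝ U z w) _ z :=
      (hd2.differentiable two_ne_zero z).hasFDerivAt.clm_apply (hasFDerivAt_const w z)
    have e3 : (fun z => inner ℝ (∇ U z) w) = fun z => fderiv ℝ U z w :=
      funext fun z => InnerProductSpace.toDual_symm_apply
    rw [e3] at e1
    have e4 := DFunLike.congr_fun (e1.unique e2) u
    simpa using e4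
  refine ContinuousLinearMap.opNorm_le_bound _ (mul_nonneg boundDHess_nonneg (norm_nonneg _)) fun u => ?_
  set X := (fderiv ℝ (∇ U) x - fderiv ℝ (∇ U) y) u with hX
  have h5 : ‖X‖ * ‖X‖ = (fderiv ℝ (fderiv ℝ U) x - fderiv ℝ (fderiv ℝ U) y) u X := by
    rw [← real_inner_self_eq_norm_mul_norm]
    nth_rw 1 [hX]
    simp only [sub_apply, inner_sub_left, h4]
  have h6 := (le_abs_self _).trans
    ((fderiv ℝ (fderiv ℝ U) x - fderiv ℝ (fderiv ℝ U) y).le_opNorm₂ u X)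
  rw [← h5] at h6
  rcases (norm_nonneg X).eq_or_lt with h0 | h0
  · rw [← h0]
    exact mul_nonneg (mul_nonneg boundDHess_nonneg (norm_nonneg _)) (norm_nonneg _)
  · refine (le_of_mul_le_mul_right h6 h0).trans ?_
    exact mul_le_mul_of_nonneg_right h3 (norm_nonneg _)

/-- The constant 1/11 is `1/12 * 12/11`. For `x = y` the second bound says that the position map,
divided by `T`, is a small Lipschitz perturbation of the identity. -/
theorem verlet_sub_bound (hU : Potential U) {h T : ℝ} {n : ℕ} (hh : 0 ≤ h) (hT : n * h = T)
    (hLT : boundHess U * T ^ 2 ≤ 1 / 6) (x y v w : E d) :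
    (∀ k ≤ n, ‖verletPos U h x k v - verletPos U h y k w‖ ≤
      12 / 11 * (‖x - y‖ + T * ‖v - w‖)) ∧
    ‖verletPos U h x n v - verletPos U h y n w - (x - y) - T • (v - w)‖ ≤
      1 / 11 * (‖x - y‖ + T * ‖v - w‖) := by
  have hT0 : 0 ≤ T := hT ▸ by positivity
  obtain ⟨h1, h2⟩ := verlet_recursion_bound
    (a := fun k => verletPos U h x k v - verletPos U h y k w)
    (b := fun k => verletVel U h x k v - verletVel U h y k w)
    (f := fun k => ∇ U (verletPos U h x k v) - ∇ U (verletPos U h y k w))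
    hh hT boundHess_nonneg hLT (c := 0)
    (fun k _ => by simp only [verletPos_succ]; module)
    (fun k _ => by simp only [verletVel_succ]; module)
    (fun k _ => by rw [add_zero]; exact norm_gradient_sub_le hU _ _) le_rfl rfl
  simp only [verletPos_zero, verletVel_zero, mul_zero, add_zero] at h1 h2
  refine ⟨h1, h2.trans ?_⟩
  have h3 : 0 ≤ ‖x - y‖ + T * ‖v - w‖ := by positivity
  nlinarith [mul_le_mul_of_nonneg_right hLT h3]

theorem contDiff_verlet (hU : Potential U) (h : ℝ) (x : E d) (k : ℕ) :
    ContDiff ℝ 1 (verletPos U h x k) ∧ ContDiff ℝ 1 (verletVel U h x k) := by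
  have hg : ContDiff ℝ 1 (∇ U) := (contDiff_gradient hU).of_le (by norm_num)
  induction k with
  | zero => exact ⟨contDiff_const, contDiff_id⟩
  | succ k ih =>
    have h1 : ContDiff ℝ 1 (verletPos U h x (k + 1)) := by
      rw [show verletPos U h x (k + 1) = _ from funext fun v => verletPos_succ h x k v]
      exact (ih.1.add (ih.2.const_smul h)).sub ((hg.comp ih.1).const_smul _)
    refine ⟨h1, ?_⟩
    rw [show verletVel U h x (k + 1) = _ from funext fun v => verletVel_succ h x k v]
    exact ih.2.sub (((hg.comp ih.1).add (hg.comp h1)).const_smul _)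

theorem hasFDerivAt_verletPos (hU : Potential U) (h : ℝ) (x : E d) (k : ℕ) (v : E d) :
    HasFDerivAt (verletPos U h x k) (fderiv ℝ (verletPos U h x k) v) v :=
  ((contDiff_verlet hU h x k).1.differentiable one_ne_zero v).hasFDerivAt

theorem hasFDerivAt_verletVel (hU : Potential U) (h : ℝ) (x : E d) (k : ℕ) (v : E d) :
    HasFDerivAt (verletVel U h x k) (fderiv ℝ (verletVel U h x k) v) v :=
  ((contDiff_verlet hU h x k).2.differentiable one_ne_zero v).hasFDerivAt

theorem hasFDerivAt_gradient_verletPos (hU : Potential U) (h : ℝ) (x : E d) (k : ℕ) (v : E d) :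
    HasFDerivAt (fun w => ∇ U (verletPos U h x k w))
      ((fderiv ℝ (∇ U) (verletPos U h x k v)).comp (fderiv ℝ (verletPos U h x k) v)) v :=
  (((contDiff_gradient hU).differentiable two_ne_zero _).hasFDerivAt).comp v
    (hasFDerivAt_verletPos hU h x k v)

theorem fderiv_verletPos_succ (hU : Potential U) (h : ℝ) (x : E d) (k : ℕ) (v : E d) :
    fderiv ℝ (verletPos U h x (k + 1)) v =
      fderiv ℝ (verletPos U h x k) v + h • fderiv ℝ (verletVel U h x k) v - (h ^ 2 / 2) •
        (fderiv ℝ (∇ U) (verletPos U h x k v)).comp (fderiv ℝ (verletPos U h x k) v) := by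
  rw [show verletPos U h x (k + 1) = _ from funext fun v => verletPos_succ h x k v]
  exact (((hasFDerivAt_verletPos hU h x k v).add
    ((hasFDerivAt_verletVel hU h x k v).const_smul h)).sub
    ((hasFDerivAt_gradient_verletPos hU h x k v).const_smul (h ^ 2 / 2))).fderiv

theorem fderiv_verletVel_succ (hU : Potential U) (h : ℝ) (x : E d) (k : ℕ) (v : E d) :
    fderiv ℝ (verletVel U h x (k + 1)) v = fderiv ℝ (verletVel U h x k) v - (h / 2) •
      ((fderiv ℝ (∇ U) (verletPos U h x k v)).comp (fderiv ℝ (verletPos U h x k) v) +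
       (fderiv ℝ (∇ U) (verletPos U h x (k + 1) v)).comp
        (fderiv ℝ (verletPos U h x (k + 1)) v)) := by
  rw [show verletVel U h x (k + 1) = _ from funext fun v => verletVel_succ h x k v]
  exact ((hasFDerivAt_verletVel hU h x k v).sub
    (((hasFDerivAt_gradient_verletPos hU h x k v).add
    (hasFDerivAt_gradient_verletPos hU h x (k + 1) v)).const_smul (h / 2))).fderiv

theorem fderiv_verletPos_zero (h : ℝ) (x v : E d) : fderiv ℝ (verletPos U h x 0) v = 0 :=
  (hasFDerivAt_const x v).fderiv

theorem fderiv_verletVel_zero (h : ℝ) (x v : E d) :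
    fderiv ℝ (verletVel U h x 0) v = ContinuousLinearMap.id ℝ (E d) :=
  (hasFDerivAt_id v).fderiv

theorem norm_fderiv_verletPos_le (hU : Potential U) {h T : ℝ} {n : ℕ} (hh : 0 ≤ h)
    (hT : n * h = T) (hLT : boundHess U * T ^ 2 ≤ 1 / 6) (x v : E d) :
    ∀ k ≤ n, ‖fderiv ℝ (verletPos U h x k) v‖ ≤ 12 / 11 * T := by
  have hT0 : 0 ≤ T := hT ▸ by positivity
  obtain ⟨h1, -⟩ := verlet_recursion_bound
    (a := fun k => fderiv ℝ (verletPos U h x k) v)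
    (b := fun k => fderiv ℝ (verletVel U h x k) v)
    (f := fun k => (fderiv ℝ (∇ U) (verletPos U h x k v)).comp (fderiv ℝ (verletPos U h x k) v))
    hh hT boundHess_nonneg hLT (c := 0)
    (fun k _ => fderiv_verletPos_succ hU h x k v)
    (fun k _ => fderiv_verletVel_succ hU h x k v)
    (fun k _ => by
      rw [add_zero]
      exact (ContinuousLinearMap.opNorm_comp_le _ _).trans
        (mul_le_mul_of_nonneg_right (norm_fderiv_gradient_le hU _) (norm_nonneg _))) le_rfl rfl
  intro k hk
  refine (h1 k hk).trans ?_
  rw [fderiv_verletPos_zero, fderiv_verletVel_zero, norm_zero, mul_zero, add_zero, zero_add]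
  have h2 : ‖ContinuousLinearMap.id ℝ (E d)‖ ≤ 1 := ContinuousLinearMap.norm_id_le
  nlinarith

/-- The difference of Jacobians solves the linearised recursion, forced by the change of the Hessian
along the two trajectories times a Jacobian; hence the two factors 12/11 in `c`. -/
theorem norm_fderiv_verletPos_sub_le (hU : Potential U) {h T : ℝ} {n : ℕ} (hh : 0 ≤ h)
    (hT : n * h = T) (hLT : boundHess U * T ^ 2 ≤ 1 / 6) (x y v w : E d) :
    ‖fderiv ℝ (verletPos U h x n) v - fderiv ℝ (verletPos U h y n) w‖ ≤
      13 / 20 * T ^ 3 * boundDHess U * (‖x - y‖ + T * ‖v - w‖) := by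
  have hT0 : 0 ≤ T := hT ▸ by positivity
  have hLH : 0 ≤ boundDHess U := boundDHess_nonneg
  set R := ‖x - y‖ + T * ‖v - w‖ with hR
  have hR0 : 0 ≤ R := by positivity
  obtain ⟨h1, -⟩ := verlet_recursion_bound
    (a := fun k => fderiv ℝ (verletPos U h x k) v - fderiv ℝ (verletPos U h y k) w)
    (b := fun k => fderiv ℝ (verletVel U h x k) v - fderiv ℝ (verletVel U h y k) w)
    (f := fun k => (fderiv ℝ (∇ U) (verletPos U h x k v)).comp (fderiv ℝ (verletPos U h x k) v) -
      (fderiv ℝ (∇ U) (verletPos U h y k w)).comp (fderiv ℝ (verletPos U h y k) w))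
    hh hT boundHess_nonneg hLT (c := boundDHess U * (12 / 11 * R) * (12 / 11 * T))
    (fun k _ => by simp only [fderiv_verletPos_succ hU]; module)
    (fun k _ => by simp only [fderiv_verletVel_succ hU]; module)
    (fun k hk => by
      set A := fderiv ℝ (∇ U) (verletPos U h x k v)
      set B := fderiv ℝ (∇ U) (verletPos U h y k w)
      set J := fderiv ℝ (verletPos U h x k) v
      set J' := fderiv ℝ (verletPos U h y k) w with hJ'
      have e : A.comp J - B.comp J' = A.comp (J - J') + (A - B).comp J' := by
        rw [ContinuousLinearMap.comp_sub, ContinuousLinearMap.sub_comp]; abel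
      have b1 : ‖A.comp (J - J')‖ ≤ boundHess U * ‖J - J'‖ :=
        (ContinuousLinearMap.opNorm_comp_le _ _).trans
          (mul_le_mul_of_nonneg_right (norm_fderiv_gradient_le hU _) (norm_nonneg _))
      have b2 : ‖(A - B).comp J'‖ ≤ boundDHess U * (12 / 11 * R) * (12 / 11 * T) := by
        refine (ContinuousLinearMap.opNorm_comp_le _ _).trans ?_
        have b3 := norm_fderiv_gradient_sub_le hU (verletPos U h x k v) (verletPos U h y k w)
        have b4 := (verlet_sub_bound hU hh hT hLT x y v w).1 k hk
        have b5 : ‖J'‖ ≤ 12 / 11 * T := norm_fderiv_verletPos_le hU hh hT hLT y w k hk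
        have b6 : ‖A - B‖ ≤ boundDHess U * (12 / 11 * R) :=
          b3.trans (mul_le_mul_of_nonneg_left b4 hLH)
        gcongr
      rw [e]
      exact (norm_add_le _ _).trans (add_le_add b1 b2)) (by positivity) rfl
  refine (h1 n le_rfl).trans ?_
  simp only [fderiv_verletPos_zero, fderiv_verletVel_zero, sub_self, norm_zero, mul_zero, add_zero,
    zero_add]
  have : 0 ≤ T ^ 3 * boundDHess U * R := by positivity
  -- `6/11 * (12/11)² = 864/1331`, just below 13/20.
  nlinarith

end Verlet

/-! ### The interpolating diffeomorphism -/

section Interpolate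

variable {V : Type*} [NormedAddCommGroup V] [NormedSpace ℝ V]

theorem norm_fderiv_sub_one_le {G : V → V} (hG : Differentiable ℝ G)
    (h : ∀ v w, ‖G v - G w - (v - w)‖ ≤ 1 / 11 * ‖v - w‖) (v : V) :
    ‖fderiv ℝ G v - 1‖ ≤ 1 / 11 := by
  have h1 : HasFDerivAt (fun w => G w - w) (fderiv ℝ G v - 1) v :=
    (hG v).hasFDerivAt.sub (hasFDerivAt_id v)
  refine h1.le_of_lip' (by norm_num) (Filter.Eventually.of_forall fun w => ?_)
  have := h w v
  rwa [show G w - w - (G v - v) = G w - G v - (w - v) by abel]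

/-- A `C¹` map uniformly close to the identity is a `C¹` diffeomorphism. -/
theorem exists_contDiff_homeomorph [CompleteSpace V] {G : V → V} (hG : ContDiff ℝ 1 G)
    (h : ∀ v w, ‖G v - G w - (v - w)‖ ≤ 1 / 11 * ‖v - w‖) :
    ∃ e : V ≃ₜ V, (∀ v, e v = G v) ∧ ContDiff ℝ 1 e.symm ∧
      ∀ v, ∃ u : (V →L[ℝ] V)ˣ, (u : V →L[ℝ] V) = fderiv ℝ G v := by
  have happ : ApproximatesLinearOn G ((ContinuousLinearEquiv.refl ℝ V : V ≃L[ℝ] V) : V →L[ℝ] V)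
      univ (1 / 11) := by
    intro v _ w _
    exact h v w
  -- The trivial space is separate because its identity has norm 0.
  have hc : Subsingleton V ∨ (1 / 11 : ℝ≥0) <
      ‖((ContinuousLinearEquiv.refl ℝ V : V ≃L[ℝ] V).symm : V →L[ℝ] V)‖₊⁻¹ := by
    rcases subsingleton_or_nontrivial V with hV | hV
    · exact Or.inl hV
    · right
      have : ‖((ContinuousLinearEquiv.refl ℝ V : V ≃L[ℝ] V).symm : V →L[ℝ] V)‖₊ = 1 :=
        NNReal.coe_injective (ContinuousLinearMap.norm_id (𝕜 := ℝ) (E := V))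
      rw [this, inv_one]
      rw [← NNReal.coe_lt_coe]
      norm_num
  let e : V ≃ₜ V := happ.toHomeomorph G hc
  have he : ∀ v, e v = G v := fun v => rfl
  have hu : ∀ v, ∃ u : (V →L[ℝ] V)ˣ, (u : V →L[ℝ] V) = fderiv ℝ G v := by
    intro v
    have h1 := norm_fderiv_sub_one_le (hG.differentiable one_ne_zero) h v
    have h2 : IsUnit (1 - (1 - fderiv ℝ G v)) := isUnit_one_sub_of_norm_lt_one (by
      rw [norm_sub_rev]; linarith)
    rw [sub_sub_cancel] at h2
    exact h2
  refine ⟨e, he, ?_, hu⟩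
  choose u hu using hu
  refine e.contDiff_symm (f₀' := fun v => ContinuousLinearEquiv.unitsEquiv ℝ V (u v)) (fun v => ?_) hG
  have : (ContinuousLinearEquiv.unitsEquiv ℝ V (u v) : V →L[ℝ] V) = fderiv ℝ G v := by
    rw [← hu v]; ext; rfl
  rw [this]
  exact (hG.differentiable one_ne_zero v).hasFDerivAt

/-- `Φ = G₂⁻¹ ∘ G₁`. Both estimates compare `G₂ ∘ Φ = G₁` with `G₂`; the factor 11/10 comes from
absorbing the 1/11 error. -/
theorem exists_interpolating_diffeo [CompleteSpace V] {G₁ G₂ : V → V}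
    (hG₁ : ContDiff ℝ 1 G₁) (hG₂ : ContDiff ℝ 1 G₂)
    (h₁ : ∀ v w, ‖G₁ v - G₁ w - (v - w)‖ ≤ 1 / 11 * ‖v - w‖)
    (h₂ : ∀ v w, ‖G₂ v - G₂ w - (v - w)‖ ≤ 1 / 11 * ‖v - w‖) {δ ε : ℝ}
    (hδ : ∀ v, ‖G₁ v - G₂ v‖ ≤ δ)
    (hε : ∀ v w, ‖v - w‖ ≤ 11 / 10 * δ → ‖fderiv ℝ G₁ v - fderiv ℝ G₂ w‖ ≤ ε) :
    ∃ Φ : V → V, ContDiff ℝ 1 Φ ∧ Function.Bijective Φ ∧ (∀ v, G₂ (Φ v) = G₁ v) ∧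
      (∀ v, ‖Φ v - v‖ ≤ 11 / 10 * δ) ∧ ∀ v, ‖fderiv ℝ Φ v - 1‖ ≤ 11 / 10 * ε := by
  obtain ⟨e₁, he₁, -, -⟩ := exists_contDiff_homeomorph hG₁ h₁
  obtain ⟨e₂, he₂, hs₂, hu₂⟩ := exists_contDiff_homeomorph hG₂ h₂
  set Φ : V → V := fun v => e₂.symm (G₁ v) with hΦ
  have hΦd : ContDiff ℝ 1 Φ := hs₂.comp hG₁
  have hcomp : ∀ v, G₂ (Φ v) = G₁ v := fun v => by rw [← he₂, hΦ]; simp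
  have hclose : ∀ v, ‖Φ v - v‖ ≤ 11 / 10 * δ := fun v => by
    have a1 := h₂ (Φ v) v
    have a2 := hδ v
    rw [hcomp] at a1
    have a3 : ‖Φ v - v‖ ≤ ‖G₁ v - G₂ v‖ + ‖G₁ v - G₂ v - (Φ v - v)‖ := by
      have := norm_sub_le (G₁ v - G₂ v) (G₁ v - G₂ v - (Φ v - v))
      rwa [sub_sub_cancel] at this
    linarith
  refine ⟨Φ, hΦd, ?_, hcomp, hclose, fun v => ?_⟩
  · have : Φ = e₁.trans e₂.symm := by
      funext v; simp [hΦ, he₁]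
    rw [this]
    exact (e₁.trans e₂.symm).bijective
  · have b1 : (fderiv ℝ G₂ (Φ v)).comp (fderiv ℝ Φ v) = fderiv ℝ G₁ v := by
      have b2 := ((hG₂.differentiable one_ne_zero (Φ v)).hasFDerivAt.comp v
        (hΦd.differentiable one_ne_zero v).hasFDerivAt).fderiv
      rw [← b2]
      congr 1
      funext w
      exact hcomp w
    set A := fderiv ℝ G₂ (Φ v) with hA
    set X := fderiv ℝ Φ v - 1 with hX
    have b3 : X = (fderiv ℝ G₁ v - A) - (A - 1) * X := by
      have : A * fderiv ℝ Φ v = fderiv ℝ G₁ v := b1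
      rw [← this, hX]
      noncomm_ring
    have b4 : ‖X‖ ≤ ε + 1 / 11 * ‖X‖ := by
      have b5 := norm_fderiv_sub_one_le (hG₂.differentiable one_ne_zero) h₂ (Φ v)
      have b6 := hε v (Φ v) (by rw [norm_sub_rev]; exact hclose v)
      have b7 := norm_sub_le (fderiv ℝ G₁ v - A) ((A - 1) * X)
      rw [← b3] at b7
      have b8 := norm_mul_le (A - 1) X
      have b9 := mul_le_mul_of_nonneg_right b5 (norm_nonneg X)
      linarith
    linarith

end Interpolate

/-! ### Regularization by Verlet -/

section Verlet

variable {d : ℕ} {U : E d → ℝ}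

/-- The constant in the one-step regularization estimate. -/
noncomputable def regConst (d : ℕ) (T LH : ℝ) : ℝ :=
  3 / 2 * √((T ^ 2)⁻¹ + 27 * d * LH ^ 2 * T ^ 4)

theorem regConst_pos {T LH : ℝ} (hT : 0 < T) : 0 < regConst d T LH := by
  unfold regConst; positivity

theorem sq_regConst (T LH : ℝ) :
    regConst d T LH ^ 2 = 9 / 4 * ((T ^ 2)⁻¹ + 27 * d * LH ^ 2 * T ^ 4) := by
  rw [regConst, mul_pow, Real.sq_sqrt (by positivity)]
  norm_num

theorem abs_integral_verlet_sub_le_of_close (hU : Potential U) {h T : ℝ} {n : ℕ} (hh : 0 ≤ h)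
    (hT0 : 0 < T) (hT : n * h = T) (hLT : boundHess U * T ^ 2 ≤ 1 / 6) {x y : E d}
    (hxy : 8 / 5 * T ^ 2 * boundDHess U * ‖x - y‖ ≤ 1 / 10) {f : E d → ℝ} (hf : Measurable f)
    (hf0 : ∀ v, 0 ≤ f v) (hf1 : ∀ v, f v ≤ 1) :
    |∫ v, f (verletPos U h x n v) ∂stdGaussian (E d) -
      ∫ v, f (verletPos U h y n v) ∂stdGaussian (E d)| ≤
      regConst d T (boundDHess U) * ‖x - y‖ := by
  rcases eq_or_ne x y with rfl | hne
  · simp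
  have hr : 0 < ‖x - y‖ := norm_pos_iff.2 (sub_ne_zero.2 hne)
  set r := ‖x - y‖ with hrdef
  set LH := boundDHess U with hLH
  have hLH0 : 0 ≤ LH := boundDHess_nonneg
  set G : E d → E d → E d := fun z v => T⁻¹ • verletPos U h z n v with hG
  have hGc : ∀ z, ContDiff ℝ 1 (G z) := fun z => (contDiff_verlet hU h z n).1.const_smul _
  have hnT : ‖T⁻¹‖ = T⁻¹ := Real.norm_of_nonneg (inv_nonneg.2 hT0.le)
  have hGl : ∀ z v w, ‖G z v - G z w - (v - w)‖ ≤ 1 / 11 * ‖v - w‖ := by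
    intro z v w
    have h1 := (verlet_sub_bound hU hh hT hLT z z v w).2
    rw [sub_self, sub_zero, norm_zero, zero_add] at h1
    have h2 : G z v - G z w - (v - w) =
        T⁻¹ • (verletPos U h z n v - verletPos U h z n w - T • (v - w)) := by
      rw [smul_sub, smul_smul, inv_mul_cancel₀ hT0.ne', one_smul, smul_sub]
    rw [h2, norm_smul, hnT, inv_mul_le_iff₀ hT0]
    linarith
  obtain ⟨Φ, hΦ, hbij, hcomp, hclose, hder⟩ := exists_interpolating_diffeo
    -- `δ` is the trajectory bound at equal velocities. In `ε`, the factor 11/5 is `1 + 6/5`: the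
    -- velocities differ by at most `11/10 * δ = 6/5 * r / T`.
    (δ := 12 / 11 * r / T) (ε := 13 / 20 * T ^ 2 * LH * (11 / 5 * r))
    (hGc x) (hGc y) (hGl x) (hGl y)
    (fun v => by
      have h1 := (verlet_sub_bound hU hh hT hLT x y v v).1 n le_rfl
      rw [sub_self, norm_zero, mul_zero, add_zero] at h1
      rw [hG]
      simp only
      rw [← smul_sub, norm_smul, hnT, inv_mul_le_iff₀ hT0, mul_div_cancel₀ _ hT0.ne']
      exact h1)
    (fun v w hvw => by
      have h1 := norm_fderiv_verletPos_sub_le hU hh hT hLT x y v w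
      have h2 : ∀ z v, fderiv ℝ (G z) v = T⁻¹ • fderiv ℝ (verletPos U h z n) v := fun z v =>
        ((hasFDerivAt_verletPos hU h z n v).const_smul T⁻¹).fderiv
      rw [h2, h2, ← smul_sub, norm_smul, hnT, inv_mul_le_iff₀ hT0]
      have h3 : T * ‖v - w‖ ≤ 6 / 5 * r := by
        calc T * ‖v - w‖ ≤ T * (11 / 10 * (12 / 11 * r / T)) := by gcongr
          _ = _ := by field_simp; norm_num
      refine h1.trans ?_
      calc 13 / 20 * T ^ 3 * LH * (r + T * ‖v - w‖) ≤ 13 / 20 * T ^ 3 * LH * (r + 6 / 5 * r) := by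
            gcongr
        _ = _ := by ring)
  set f' : E d → ℝ := fun w => f (T • w) with hf'
  have hfG : ∀ z v, f (verletPos U h z n v) = f' (G z v) := fun z v => by
    simp only [hf', hG, smul_smul, mul_inv_cancel₀ hT0.ne', one_smul]
  simp_rw [hfG, ← hcomp]
  rw [abs_sub_comm]
  -- Here 8/5 rounds up `11/10 * 13/20 * 11/5`. The resulting coefficients 18/25 and 192/25 lie
  -- below the available 9/4 and 243/4.
  have hK : (6 / 5 * r / T) ^ 2 / 2 + 3 * Module.finrank ℝ (E d) * (8 / 5 * T ^ 2 * LH * r) ^ 2 ≤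
      (regConst d T LH * r) ^ 2 := by
    rw [finrank_euclideanSpace_fin, mul_pow (regConst d T LH), sq_regConst]
    have h1 : (6 / 5 * r / T) ^ 2 / 2 = 18 / 25 * ((T ^ 2)⁻¹ * r ^ 2) := by field_simp; norm_num
    have h2 : 0 ≤ (T ^ 2)⁻¹ * r ^ 2 := by positivity
    have h3 : 0 ≤ d * LH ^ 2 * T ^ 4 * r ^ 2 := by positivity
    rw [h1]
    nlinarith
  have hpos : 0 < regConst d T LH * r := mul_pos (regConst_pos hT0) hr
  have := abs_integral_sub_integral_comp_le hΦ hbij (a := 6 / 5 * r / T)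
    (b := 8 / 5 * T ^ 2 * LH * r) (fun v => (hclose v).trans (le_of_eq (by ring))) hxy
    (fun v => (hder v).trans (by
      have : 0 ≤ T ^ 2 * LH * r := by positivity
      nlinarith)) (pow_pos hpos 2) hK (f := fun v => f' (G y v))
    ((hf.comp (measurable_const_smul T)).comp (hGc y).continuous.measurable)
    (fun _ => hf0 _) (fun _ => hf1 _)
  rwa [Real.sqrt_sq hpos.le] at this

end Verlet

/-- A real function which is Lipschitz at small scales is globally Lipschitz. -/
theorem abs_sub_le_of_locally {W : Type*} [NormedAddCommGroup W] [NormedSpace ℝ W] {F : W → ℝ}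
    {C c : ℝ} (hc : ∀ x y, c * ‖x - y‖ ≤ 1 / 10 → |F x - F y| ≤ C * ‖x - y‖) (x y : W) :
    |F x - F y| ≤ C * ‖x - y‖ := by
  -- The segment is cut into `N + 1` equal pieces, short enough for the local hypothesis; the `+ 1`
  -- keeps the number positive.
  obtain ⟨N, hN⟩ := exists_nat_gt (10 * (c * ‖x - y‖))
  set M : ℝ := N + 1 with hM
  have hM0 : 0 < M := by positivity
  let p : ℕ → W := fun k => y + ((k : ℝ) / M) • (x - y)
  have hp : ∀ k, ‖p (k + 1) - p k‖ = ‖x - y‖ / M := fun k => by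
    have : p (k + 1) - p k = M⁻¹ • (x - y) := by
      simp only [p]
      rw [add_sub_add_left_eq_sub, ← sub_smul]
      congr 1
      push_cast
      field_simp
      ring
    rw [this, norm_smul, norm_inv, Real.norm_of_nonneg hM0.le]
    ring
  have hstep : ∀ k : ℕ, |F (p k) - F (p 0)| ≤ k * (C * (‖x - y‖ / M)) := by
    intro k
    induction k with
    | zero => simp
    | succ k ih =>
      have h1 := hc (p (k + 1)) (p k) (by
        rw [hp, mul_div_assoc', div_le_iff₀ hM0]
        linarith)
      rw [hp] at h1
      have h2 := abs_sub_le (F (p (k + 1))) (F (p k)) (F (p 0))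
      push_cast
      linarith
  have h1 := hstep (N + 1)
  have e1 : p (N + 1) = x := by
    simp only [p]
    push_cast
    rw [← hM, div_self hM0.ne', one_smul]
    abel
  have e0 : p 0 = y := by simp [p]
  rw [e1, e0] at h1
  refine h1.trans (le_of_eq ?_)
  push_cast
  rw [← hM]
  field_simp

theorem abs_integral_verlet_sub_le {d : ℕ} {U : E d → ℝ} (hU : Potential U) {h T : ℝ} {n : ℕ}
    (hh : 0 ≤ h) (hT0 : 0 < T) (hT : n * h = T) (hLT : boundHess U * T ^ 2 ≤ 1 / 6) (x y : E d)
    {f : E d → ℝ} (hf : Measurable f) (hf0 : ∀ v, 0 ≤ f v) (hf1 : ∀ v, f v ≤ 1) :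
    |∫ v, f (verletPos U h x n v) ∂stdGaussian (E d) -
      ∫ v, f (verletPos U h y n v) ∂stdGaussian (E d)| ≤
      regConst d T (boundDHess U) * ‖x - y‖ :=
  abs_sub_le_of_locally (F := fun z => ∫ v, f (verletPos U h z n v) ∂stdGaussian (E d))
    (fun _ _ h' => abs_integral_verlet_sub_le_of_close hU hh hT0 hT hLT h' hf hf0 hf1) x y

/-! ### The exact flow as a limit of Verlet -/

section Flow

variable {d : ℕ} {U : E d → ℝ}

theorem IsTrajectory.hasDerivAt_fst {γ : ℝ → E d × E d} (hγ : IsTrajectory U γ) (t : ℝ) :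
    HasDerivAt (fun s => (γ s).1) (γ t).2 t :=
  (hasFDerivAt_fst (𝕜 := ℝ) (p := γ t)).comp_hasDerivAt t (hγ t)

theorem IsTrajectory.hasDerivAt_snd {γ : ℝ → E d × E d} (hγ : IsTrajectory U γ) (t : ℝ) :
    HasDerivAt (fun s => (γ s).2) (-∇ U (γ t).1) t :=
  (hasFDerivAt_snd (𝕜 := ℝ) (p := γ t)).comp_hasDerivAt t (hγ t)

/-- The local error of one Verlet step along an exact trajectory. -/
theorem IsTrajectory.exists_local_error (hU : Potential U) {γ : ℝ → E d × E d}
    (hγ : IsTrajectory U γ) (T : ℝ) : ∃ K, 0 ≤ K ∧ ∀ t h, 0 ≤ t → 0 ≤ h → t + h ≤ T →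
      ‖∇ U (γ (t + h)).1 - ∇ U (γ t).1‖ ≤ K * h ∧
      ‖(γ (t + h)).2 - (γ t).2 + h • ∇ U (γ t).1‖ ≤ K * h ^ 2 ∧
      ‖(γ (t + h)).1 - (γ t).1 - h • (γ t).2 + (h ^ 2 / 2) • ∇ U (γ t).1‖ ≤ K * h ^ 3 := by
  have hc : Continuous fun t => (γ t).2 :=
    continuous_iff_continuousAt.2 fun t => (hγ.hasDerivAt_snd t).continuousAt
  -- The speed is bounded on the compact time interval, so the constant depends on the trajectory.
  -- This is enough for convergence at each fixed initial velocity.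
  obtain ⟨P, hP⟩ := (isCompact_Icc (a := (0 : ℝ)) (b := T)).exists_bound_of_continuousOn
    hc.continuousOn
  refine ⟨boundHess U * max P 0, mul_nonneg boundHess_nonneg (le_max_right _ _), ?_⟩
  intro t h ht hh hth
  set K := boundHess U * max P 0 with hK
  have hK0 : 0 ≤ K := mul_nonneg boundHess_nonneg (le_max_right _ _)
  have hmem : ∀ s ∈ Icc 0 h, t + s ∈ Icc 0 T := fun s hs => ⟨by linarith [hs.1], by linarith [hs.2]⟩
  have hdq : ∀ s, HasDerivAt (fun s => (γ (t + s)).1) (γ (t + s)).2 s := fun s =>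
    (hγ.hasDerivAt_fst (t + s)).comp_const_add t s
  have hdp : ∀ s, HasDerivAt (fun s => (γ (t + s)).2) (-∇ U (γ (t + s)).1) s := fun s =>
    (hγ.hasDerivAt_snd (t + s)).comp_const_add t s
  have mv : ∀ (F F' : ℝ → E d) (C : ℝ), (∀ s, HasDerivAt F (F' s) s) →
      (∀ s ∈ Icc 0 h, ‖F' s‖ ≤ C) → ∀ s ∈ Icc 0 h, ‖F s - F 0‖ ≤ C * s := by
    intro F F' C hF hC s hs
    have := (convex_Icc 0 h).norm_image_sub_le_of_norm_hasDerivWithin_le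
      (fun u _ => (hF u).hasDerivWithinAt) hC (left_mem_Icc.2 hh) hs
    rwa [sub_zero, Real.norm_of_nonneg hs.1] at this
  have hf : ∀ s ∈ Icc 0 h, ‖∇ U (γ (t + s)).1 - ∇ U (γ t).1‖ ≤ K * s := by
    intro s hs
    have h1 := mv _ _ (max P 0) hdq (fun s hs => (hP _ (hmem s hs)).trans (le_max_left _ _)) s hs
    rw [add_zero] at h1
    refine (norm_gradient_sub_le hU _ _).trans ?_
    have := mul_le_mul_of_nonneg_left h1 (boundHess_nonneg (U := U))
    rw [hK]; linarith
  have hsh : ∀ s ∈ Icc 0 h, K * s ≤ K * h := fun s hs => mul_le_mul_of_nonneg_left hs.2 hK0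
  have hp : ∀ s ∈ Icc 0 h, ‖(γ (t + s)).2 - (γ t).2 + s • ∇ U (γ t).1‖ ≤ K * h * s := by
    intro s hs
    have h1 := mv (fun s => (γ (t + s)).2 + s • ∇ U (γ t).1)
      (fun s => -∇ U (γ (t + s)).1 + (1 : ℝ) • ∇ U (γ t).1) (K * h)
      (fun s => (hdp s).add ((hasDerivAt_id s).smul_const _))
      (fun s hs => by
        rw [one_smul, neg_add_eq_sub, norm_sub_rev]
        exact (hf s hs).trans (hsh s hs)) s hs
    simp only [add_zero, zero_smul] at h1
    convert h1 using 2
    abel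
  have hq : ∀ s ∈ Icc 0 h,
      ‖(γ (t + s)).1 - (γ t).1 - s • (γ t).2 + (s ^ 2 / 2) • ∇ U (γ t).1‖ ≤ K * h ^ 2 * s := by
    intro s hs
    have h1 := mv (fun s => (γ (t + s)).1 - s • (γ t).2 + (s ^ 2 / 2) • ∇ U (γ t).1)
      (fun s => (γ (t + s)).2 - (1 : ℝ) • (γ t).2 + s • ∇ U (γ t).1) (K * h ^ 2)
      (fun s => ((hdq s).sub ((hasDerivAt_id s).smul_const _)).add
        (HasDerivAt.smul_const (by
          have := ((hasDerivAt_id s).pow 2).div_const 2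
          simpa using this) _))
      (fun s hs => by
        rw [one_smul]
        refine (hp s hs).trans ?_
        have := mul_le_mul_of_nonneg_left hs.2 (mul_nonneg hK0 hh)
        nlinarith) s hs
    simp only [add_zero, zero_smul, ne_eq, OfNat.ofNat_ne_zero, not_false_eq_true, zero_pow,
      zero_div, sub_zero] at h1
    convert h1 using 2
    abel
  have hhh : h ∈ Icc 0 h := right_mem_Icc.2 hh
  exact ⟨hf h hhh, (hp h hhh).trans (le_of_eq (by ring)), (hq h hhh).trans (le_of_eq (by ring))⟩

/-- Consistency plus stability: the error solves the Verlet recursion up to local errors, which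
enter the Gronwall bound as the inhomogeneity. -/
theorem norm_verletPos_sub_trajectory_le (hU : Potential U) {γ : ℝ → E d × E d}
    (hγ : IsTrajectory U γ) {T : ℝ} (hLT : boundHess U * T ^ 2 ≤ 1 / 6) :
    ∃ C, ∀ (n : ℕ) (h : ℝ), 0 ≤ h → n * h = T →
      ‖verletPos U h (γ 0).1 n (γ 0).2 - (γ T).1‖ ≤ C * h := by
  obtain ⟨K, hK0, hK⟩ := hγ.exists_local_error hU T
  refine ⟨12 / 11 * (T ^ 2 * K), fun n h hh hT => ?_⟩
  have hL0 := boundHess_nonneg (U := U)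
  set x := (γ 0).1
  set v := (γ 0).2
  obtain ⟨h1, -⟩ := discrete_gronwall_bound
    (a := fun k => verletPos U h x k v - (γ (k * h)).1)
    (b := fun k => verletVel U h x k v - (γ (k * h)).2)
    -- The local position error `K * h ^ 3` equals `h ^ 2 / 2 * c`; the velocity error `3 / 2 * K *
    -- h ^ 2` fits below `h * c`.
    (c := 2 * K * h) hh hT hL0 hLT (fun M hM k hk => by
      have hkn : (k : ℝ) + 1 ≤ n := by exact_mod_cast hk
      obtain ⟨e0, e1, e2⟩ := hK (k * h) h (by positivity) hh (by
        rw [← hT]; nlinarith)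
      have ht : ((k + 1 : ℕ) : ℝ) * h = k * h + h := by push_cast; ring
      have m1 := hM k hk.le
      have m2 := hM (k + 1) hk
      simp only [ht] at m2 ⊢
      set t := (k : ℝ) * h
      have g1 : ‖∇ U (verletPos U h x k v) - ∇ U (γ t).1‖ ≤ boundHess U * M :=
        (norm_gradient_sub_le hU _ _).trans (mul_le_mul_of_nonneg_left m1 hL0)
      have g2 : ‖∇ U (verletPos U h x (k + 1) v) - ∇ U (γ (t + h)).1‖ ≤ boundHess U * M :=
        (norm_gradient_sub_le hU _ _).trans (mul_le_mul_of_nonneg_left m2 hL0)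
      constructor
      · rw [verletVel_succ]
        have e : verletVel U h x k v -
              (h / 2) • (∇ U (verletPos U h x k v) + ∇ U (verletPos U h x (k + 1) v)) -
              (γ (t + h)).2 - (verletVel U h x k v - (γ t).2) =
            -((h / 2) • (∇ U (verletPos U h x k v) - ∇ U (γ t).1) +
              (h / 2) • (∇ U (verletPos U h x (k + 1) v) - ∇ U (γ (t + h)).1) +
              ((γ (t + h)).2 - (γ t).2 + h • ∇ U (γ t).1) +
              (h / 2) • (∇ U (γ (t + h)).1 - ∇ U (γ t).1)) := by module
        rw [e, norm_neg]
        refine (norm_add₄_le).trans ?_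
        rw [norm_smul, norm_smul, norm_smul, Real.norm_of_nonneg (by positivity)]
        calc _ ≤ h / 2 * (boundHess U * M) + h / 2 * (boundHess U * M) + K * h ^ 2 +
              h / 2 * (K * h) := by gcongr
          _ ≤ _ := by nlinarith [mul_nonneg hK0 (sq_nonneg h)]
      · rw [verletPos_succ]
        have e : verletPos U h x k v + h • verletVel U h x k v -
              (h ^ 2 / 2) • ∇ U (verletPos U h x k v) - (γ (t + h)).1 -
              (verletPos U h x k v - (γ t).1) - h • (verletVel U h x k v - (γ t).2) =
            -((h ^ 2 / 2) • (∇ U (verletPos U h x k v) - ∇ U (γ t).1) +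
              ((γ (t + h)).1 - (γ t).1 - h • (γ t).2 + (h ^ 2 / 2) • ∇ U (γ t).1)) := by module
        rw [e, norm_neg]
        refine (norm_add_le _ _).trans ?_
        rw [norm_smul, Real.norm_of_nonneg (by positivity)]
        calc _ ≤ h ^ 2 / 2 * (boundHess U * M) + K * h ^ 3 := by gcongr
          _ = _ := by ring) rfl (by positivity)
  have h2 := h1 n le_rfl
  simp only [hT, verletPos_zero, verletVel_zero, Nat.cast_zero, zero_mul] at h2
  refine h2.trans (le_of_eq ?_)
  simp only [x, v, sub_self, norm_zero]
  ring

theorem tendsto_verletPos_hamFlow (hU : Potential U) {T : ℝ} (hT : 0 < T)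
    (hLT : boundHess U * T ^ 2 ≤ 1 / 6) (x v : E d) :
    Filter.Tendsto (fun n : ℕ => verletPos U (T / (n + 1)) x (n + 1) v) Filter.atTop
      (nhds (hamFlow U T (x, v)).1) := by
  obtain ⟨h0, hγ⟩ := hamFlow_spec hU (x, v)
  obtain ⟨C, hC⟩ := norm_verletPos_sub_trajectory_le hU hγ hLT
  rw [tendsto_iff_norm_sub_tendsto_zero]
  have hlim : Filter.Tendsto (fun n : ℕ => C * (T / ((n : ℝ) + 1))) Filter.atTop (nhds 0) := by
    have := (tendsto_one_div_add_atTop_nhds_zero_nat (𝕜 := ℝ)).const_mul (C * T)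
    rw [mul_zero] at this
    refine this.congr fun n => ?_
    ring
  refine squeeze_zero (fun _ => norm_nonneg _) (fun n => ?_) hlim
  have := hC (n + 1) (T / (n + 1)) (by positivity) (by push_cast; field_simp)
  simpa only [h0] using this

/-- The Verlet constant does not depend on the step size, so it survives the limit by dominated
convergence. Pointwise convergence of positions requires `f` continuous. -/
theorem abs_integral_hamFlow_sub_le (hU : Potential U) {T : ℝ} (hT : 0 < T)
    (hLT : boundHess U * T ^ 2 ≤ 1 / 6) (x y : E d) {f : E d → ℝ} (hf : Continuous f)
    (hf0 : ∀ v, 0 ≤ f v) (hf1 : ∀ v, f v ≤ 1) :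
    |∫ v, f (hamFlow U T (x, v)).1 ∂stdGaussian (E d) -
      ∫ v, f (hamFlow U T (y, v)).1 ∂stdGaussian (E d)| ≤
      regConst d T (boundDHess U) * ‖x - y‖ := by
  have hlim : ∀ z, Filter.Tendsto
      (fun n : ℕ => ∫ v, f (verletPos U (T / (n + 1)) z (n + 1) v) ∂stdGaussian (E d))
      Filter.atTop (nhds (∫ v, f (hamFlow U T (z, v)).1 ∂stdGaussian (E d))) := by
    intro z
    refine tendsto_integral_of_dominated_convergence (fun _ => 1)
      (fun n => (hf.comp (contDiff_verlet hU _ z _).1.continuous).aestronglyMeasurable)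
      (integrable_const 1) (fun n => Filter.Eventually.of_forall fun v => ?_)
      (Filter.Eventually.of_forall fun v =>
        (hf.tendsto _).comp (tendsto_verletPos_hamFlow hU hT hLT z v))
    rw [Real.norm_eq_abs, abs_of_nonneg (hf0 _)]
    exact hf1 _
  refine le_of_tendsto ((hlim x).sub (hlim y)).abs (Filter.Eventually.of_forall fun n => ?_)
  exact abs_integral_verlet_sub_le hU (by positivity) hT (by push_cast; field_simp) hLT x y
    hf.measurable hf0 hf1

end Flow

/-! ### From continuous functions to Borel sets -/

/-- The indicator of a closed set is the pointwise limit of the continuous thickened indicators. -/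
theorem measureReal_isClosed_le_of_continuous {Ω : Type*} [MeasurableSpace Ω]
    [PseudoMetricSpace Ω] [BorelSpace Ω] {μ ν : Measure Ω} [IsProbabilityMeasure μ]
    [IsProbabilityMeasure ν] {c : ℝ} (h : ∀ f : Ω → ℝ, Continuous f → (∀ x, 0 ≤ f x) →
      (∀ x, f x ≤ 1) → ∫ x, f x ∂μ ≤ ∫ x, f x ∂ν + c) {F : Set Ω} (hF : IsClosed F) :
    μ.real F ≤ ν.real F + c := by
  have hpos : ∀ n : ℕ, 0 < 1 / ((n : ℝ) + 1) := fun n => by positivity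
  let f : ℕ → Ω → ℝ := fun n x => thickenedIndicator (hpos n) F x
  have hfc : ∀ n, Continuous (f n) := fun n =>
    NNReal.continuous_coe.comp (thickenedIndicator (hpos n) F).continuous
  have hf1 : ∀ n x, f n x ≤ 1 := fun n x => by
    exact NNReal.coe_le_coe.2 (thickenedIndicator_le_one (hpos n) F x)
  have hf0 : ∀ n x, 0 ≤ f n x := fun n x => NNReal.coe_nonneg _
  have hlim : ∀ (ρ : Measure Ω) [IsProbabilityMeasure ρ],
      Filter.Tendsto (fun n => ∫ x, f n x ∂ρ) Filter.atTop (nhds (ρ.real F)) := by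
    intro ρ _
    rw [← integral_indicator_one hF.measurableSet]
    refine tendsto_integral_of_dominated_convergence (fun _ => 1)
      (fun n => (hfc n).aestronglyMeasurable) (integrable_const 1)
      (fun n => Filter.Eventually.of_forall fun x => by
        rw [Real.norm_eq_abs, abs_of_nonneg (hf0 n x)]; exact hf1 n x)
      (Filter.Eventually.of_forall fun x => ?_)
    have h1 := tendsto_pi_nhds.1 (thickenedIndicator_tendsto_indicator_closure hpos
      (tendsto_one_div_add_atTop_nhds_zero_nat (𝕜 := ℝ)) F) x
    rw [hF.closure_eq] at h1
    have h2 : F.indicator 1 x = ((F.indicator (fun _ => (1 : ℝ≥0)) x : ℝ≥0) : ℝ) := by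
      by_cases hx : x ∈ F <;> simp [hx]
    rw [h2]
    exact (NNReal.continuous_coe.tendsto _).comp h1
  exact le_of_tendsto_of_tendsto' (hlim μ) ((hlim ν).add_const c)
    fun n => h _ (hfc n) (hf0 n) (hf1 n)

/-- Inner regularity of `μ` by closed sets, with monotonicity of `ν`. -/
theorem measureReal_le_of_continuous {Ω : Type*} [MeasurableSpace Ω]
    [PseudoMetricSpace Ω] [BorelSpace Ω] {μ ν : Measure Ω} [IsProbabilityMeasure μ]
    [IsProbabilityMeasure ν] {c : ℝ} (h : ∀ f : Ω → ℝ, Continuous f → (∀ x, 0 ≤ f x) →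
      (∀ x, f x ≤ 1) → ∫ x, f x ∂μ ≤ ∫ x, f x ∂ν + c) {A : Set Ω} (hA : MeasurableSet A) :
    μ.real A ≤ ν.real A + c := by
  refine le_of_forall_pos_le_add fun ε hε => ?_
  obtain ⟨F, hFA, hF, hlt⟩ := hA.exists_isClosed_lt_add (measure_ne_top μ A)
    (ENNReal.ofReal_pos.2 hε).ne'
  have h1 := measureReal_isClosed_le_of_continuous h hF
  have h2 : μ.real A ≤ μ.real F + ε := by
    have := ENNReal.toReal_mono (by finiteness) hlt.le
    rwa [ENNReal.toReal_add (by finiteness) (by finiteness), ENNReal.toReal_ofReal hε.le] at this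
  have h3 : ν.real F ≤ ν.real A := measureReal_mono hFA
  linarith

/-! ### Transition kernel and couplings -/

section Kernel

variable {d : ℕ} {U : E d → ℝ}

theorem measurable_numFlow_fst (hU : Potential U) (h T : ℝ) (x : E d) :
    Measurable fun v => (numFlow U h T (x, v)).1 :=
  ((continuous_fst.comp (continuous_numFlow hU h T)).comp (by fun_prop)).measurable

theorem isMarkovKernel_kernel (hU : Potential U) (h T : ℝ) : IsMarkovKernel (kernel hU h T) :=
  ⟨fun x => Measure.isProbabilityMeasure_map (measurable_numFlow_fst hU h T x).aemeasurable⟩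

theorem integral_kernel (hU : Potential U) (h T : ℝ) (x : E d) {f : E d → ℝ} (hf : Measurable f) :
    ∫ z, f z ∂kernel hU h T x = ∫ v, f (numFlow U h T (x, v)).1 ∂stdGaussian (E d) :=
  integral_map (measurable_numFlow_fst hU h T x).aemeasurable hf.aestronglyMeasurable

theorem kernel_real_sub_le (hU : Potential U) {T h : ℝ} (hT : 0 < T) (hh : 0 ≤ h)
    (hTh : h ≠ 0 → ∃ N : ℕ, T / h = N) (hL : boundHess U * (T ^ 2 + T * h) ≤ 1 / 6)
    (x y : E d) {A : Set (E d)} (hA : MeasurableSet A) :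
    (kernel hU h T x).real A ≤
      (kernel hU h T y).real A + regConst d T (boundDHess U) * ‖x - y‖ := by
  have hLT : boundHess U * T ^ 2 ≤ 1 / 6 := by
    have := mul_nonneg (boundHess_nonneg (U := U)) (mul_nonneg hT.le hh)
    linarith
  have := isMarkovKernel_kernel hU h T
  refine measureReal_le_of_continuous (fun f hf hf0 hf1 => ?_) hA
  rw [← sub_le_iff_le_add', integral_kernel hU h T x hf.measurable,
    integral_kernel hU h T y hf.measurable]
  refine (le_abs_self _).trans ?_
  by_cases h0 : h = 0
  · simp only [numFlow, if_pos h0]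
    exact abs_integral_hamFlow_sub_le hU hT hLT x y hf hf0 hf1
  · obtain ⟨N, hN⟩ := hTh h0
    simp only [numFlow, if_neg h0, hN, Nat.floor_natCast]
    exact abs_integral_verlet_sub_le hU hh hT (by rw [← hN, div_mul_cancel₀ _ h0]) hLT x y
      hf.measurable hf0 hf1

theorem kernel_apply_le (hU : Potential U) {T h : ℝ} (hT : 0 < T) (hh : 0 ≤ h)
    (hTh : h ≠ 0 → ∃ N : ℕ, T / h = N) (hL : boundHess U * (T ^ 2 + T * h) ≤ 1 / 6)
    (x y : E d) {A : Set (E d)} (hA : MeasurableSet A) :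
    kernel hU h T x A ≤
      kernel hU h T y A + ENNReal.ofReal (regConst d T (boundDHess U)) * edist x y := by
  have := isMarkovKernel_kernel hU h T
  have h1 := kernel_real_sub_le hU hT hh hTh hL x y hA
  rw [edist_dist, dist_eq_norm, ← ENNReal.ofReal_mul (regConst_pos hT).le,
    ← ofReal_measureReal, ← ofReal_measureReal,
    ← ENNReal.ofReal_add measureReal_nonneg (mul_nonneg (regConst_pos hT).le (norm_nonneg _))]
  exact ENNReal.ofReal_le_ofReal h1

/-- The pointwise inequality is integrated against `ω`, whose marginals turn the two kernel terms
into the laws after one step. -/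
theorem bind_kernel_le_of_coupling {κ : Kernel (E d) (E d)} {C : ℝ≥0∞}
    {A : Set (E d)} (hA : MeasurableSet A) (hκ : ∀ x y, κ x A ≤ κ y A + C * edist x y)
    {η ν : Measure (E d)} {ω : Measure (E d × E d)} (hω : IsCoupling ω η ν) :
    η.bind κ A ≤ ν.bind κ A + C * ∫⁻ p, edist p.1 p.2 ∂ω := by
  have hm : Measurable fun x => κ x A := κ.measurable_coe hA
  rw [Measure.bind_apply hA κ.aemeasurable, Measure.bind_apply hA κ.aemeasurable, ← hω.1, ← hω.2,
    lintegral_map hm measurable_fst, lintegral_map hm measurable_snd,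
    ← lintegral_const_mul _ (by fun_prop),
    ← lintegral_add_left (f := fun p : E d × E d => κ p.2 A) (hm.comp measurable_snd)]
  exact lintegral_mono fun p => hκ p.1 p.2

theorem IsCoupling.swap {η ν : Measure (E d)} {ω : Measure (E d × E d)} (hω : IsCoupling ω η ν) :
    IsCoupling (ω.map Prod.swap) ν η := by
  constructor
  · rw [Measure.map_map measurable_fst measurable_swap, ← hω.2]; rfl
  · rw [Measure.map_map measurable_snd measurable_swap, ← hω.1]; rfl

theorem lintegral_edist_swap (ω : Measure (E d × E d)) :
    ∫⁻ p, edist p.1 p.2 ∂ω.map Prod.swap = ∫⁻ p, edist p.1 p.2 ∂ω := by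
  rw [lintegral_map (by fun_prop) measurable_swap]
  simp_rw [Prod.fst_swap, Prod.snd_swap, edist_comm]

theorem tv_le_of_le {μ ν : Measure (E d)} [IsProbabilityMeasure μ] [IsProbabilityMeasure ν]
    {c : ℝ≥0∞} (h1 : ∀ A, MeasurableSet A → μ A ≤ ν A + c)
    (h2 : ∀ A, MeasurableSet A → ν A ≤ μ A + c) : tv μ ν ≤ c := by
  refine iSup₂_le fun A hA => ?_
  -- An infinite cost must be separated, since `ENNReal.toReal` sends `∞` to 0.
  rcases eq_or_ne c ∞ with rfl | hc
  · exact le_top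
  refine ENNReal.ofReal_le_of_le_toReal ?_
  have key : ∀ ρ σ : Measure (E d), IsProbabilityMeasure σ → ρ A ≤ σ A + c →
      ρ.real A ≤ σ.real A + c.toReal := fun ρ σ _ h => by
    have := ENNReal.toReal_mono (by finiteness) h
    rwa [ENNReal.toReal_add (by finiteness) hc] at this
  have a1 := key μ ν inferInstance (h1 A hA)
  have a2 := key ν μ inferInstance (h2 A hA)
  exact abs_sub_le_iff.2 ⟨by linarith, by linarith⟩

end Kernel

end UHMC

theorem mainTheorem2 {d : ℕ} {U : UHMC.E d → ℝ} (hU : UHMC.Potential U) {T h : ℝ}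
    (hT : 0 < T) (hh : 0 ≤ h) (hTh : h ≠ 0 → ∃ N : ℕ, T / h = N)
    (hL : UHMC.boundHess U * (T ^ 2 + T * h) ≤ 1 / 6)
    (η ν : Measure (UHMC.E d)) [IsProbabilityMeasure η] [IsProbabilityMeasure ν] :
    UHMC.tv (η.bind (UHMC.kernel hU h T)) (ν.bind (UHMC.kernel hU h T)) ≤
      ENNReal.ofReal (3 / 2 * √((T ^ 2)⁻¹ + 27 * d * UHMC.boundDHess U ^ 2 * T ^ 4)) *
        UHMC.wass η ν := by
  have := UHMC.isMarkovKernel_kernel hU h T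
  change _ ≤ ENNReal.ofReal (UHMC.regConst d T (UHMC.boundDHess U)) * _
  set C := ENNReal.ofReal (UHMC.regConst d T (UHMC.boundDHess U)) with hC
  have hC0 : C ≠ 0 := (ENNReal.ofReal_pos.2 (UHMC.regConst_pos hT)).ne'
  have hC1 : C ≠ ∞ := ENNReal.ofReal_ne_top
  -- A nonzero finite constant passes through the infimum, reducing the claim to a single coupling.
  rw [UHMC.wass, ENNReal.mul_iInf_of_ne hC0 hC1]
  refine le_iInf fun ω => ?_
  rw [ENNReal.mul_iInf_of_ne hC0 hC1]
  refine le_iInf fun hω => UHMC.tv_le_of_le (fun A hA => ?_) fun A hA => ?_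
  · exact UHMC.bind_kernel_le_of_coupling hA
      (fun x y => UHMC.kernel_apply_le hU hT hh hTh hL x y hA) hω
  -- The reverse inequality is the same bound for the swapped coupling, which has equal cost.
  · rw [← UHMC.lintegral_edist_swap]
    exact UHMC.bind_kernel_le_of_coupling hA
      (fun x y => UHMC.kernel_apply_le hU hT hh hTh hL x y hA) hω.swap
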